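/- **Setting.** Let $X,Y$ be complex Hilbert spaces and let $K(s):X\to Y$ be a family of bounded linear operators, analytic for $\operatorname{Re}s>0$, with $\|K(s)\|\le M_0|s|^{\mu}$ for $\operatorname{Re}s>0$, where $\mu\ge -1$. For continuous $g:\mathbb R\to X$ vanishing on $(-\infty,0)$ let $u=K(\partial_t)g=(\mathcal L^{-1}K)*g$, i.e. $u$ is continuous on $[0,\infty)$ and $\mathcal Lu(s)=K(s)\,\mathcal Lg(s)$ on some right half plane (we assume that such a $u$ exists). Fix $T>0$, $k>0$. For $N\in\mathbb N$ put $\tau=T/N$, $t_n=n\tau$, $g^n=g(t_n)$, $\delta(\zeta)=1-\zeta$ (implicit Euler), and $\|(x^n)\|_{\ell^2_N}=\big(N^{-1}\sum_{n=0}^N\|x^n\|^2\big)^{1/2}$. The convolution quadrature (CQ) approximation is $(K(\partial_t^\tau)g)_n=\sum_{j=0}^n W_{n-j}g^j$, where $K(\delta(\zeta)/\tau)=\sum_n W_n\zeta^n$. **Method.** Given $0\le\epsilon_{\rm mach}<1$, choose $$\epsilon=\max\{\tau^{2(k+\mu+1)},\epsilon_{\rm mach}\},\qquad p=\lceil-\log_2\epsilon\rceil,\qquad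 \lambda=\epsilon^{1/(2N)}.$$ Define $\Phi_0=\sqrt{10|\log\epsilon|/(6N)}$ and $$\Phi_{j+1}=\Phi_j+\min\{\Phi_j,\,-\tfrac83\log\lambda-\tfrac83\log\cos(\tfrac78\Phi_j)\}\ \text{ if }\Phi_j<1,\qquad \Phi_{j+1}=\pi\ \text{ otherwise,}$$ let $M=\min\{j:\Phi_j=\pi\}$ and $\Phi_{-1}=0$, and let $\mathcal T$ be the mesh of $[0,2\pi]$ consisting of the $2M+2$ intervals $[\Phi_{j-1},\Phi_j]$ and $[2\pi-\Phi_j,2\pi-\Phi_{j-1}]$, $0\le j\le M$. Let $I_p^{\mathcal T}$ be the identity on the first and the last interval of $\mathcal T$, and on every other interval interpolation of degree $p$ in its $p+1$ Chebyshev points. With $L=N$ and $\zeta_L=e^{2\pi i/L}$ the parsimonious CQ is $$(I_p^{\mathcal T}K(\partial_t^{\tau,\lambda})g)_n=\frac{\lambda^{-n}}{L}\sum_{l=0}^{L-1}\zeta_L^{ln}\Big(I_p^{\mathcal T}\big[\varphi\mapsto K(\delta(\lambda e^{i\varphi})/\tau)\big]\Big)\Big(2\pi-\frac{2\pi l}{L}\Big)\sum_{j=0}^N\lambda^j\zeta_L^{-jl}g^j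 .$$ **Statement.** For all $\mu\ge-1$, $k>0$, $T>0$ and $\epsilon_0\in(0,1)$ there are $C>0$ and $N_0\ge 1$, depending only on these numbers, such that for all $N\ge N_0$ and all $\epsilon_{\rm mach}\in[0,\epsilon_0]$: 1. $0<\lambda<1$, the recursion reaches $\pi$, and $0<\Phi_0<\dots<\Phi_M=\pi$. The mesh has $\#\mathcal T=2M+2\le C\sqrt N$ elements. 2. The method evaluates $K$ only at points of the half plane $\operatorname{Re}s>0$, namely at the sample points $\delta(\lambda\zeta_L^{-l})/\tau$ belonging to the first and the last element, and at those belonging to the $p+1$ Chebyshev points of each other element. Its output depends on $K$ only through these values. The number of evaluations is at most $C(\sqrt N\sqrt{\log N}+Mp)$ and at most $C\sqrt N\log N$. 3. For all $X,Y,K,M_0,g,u$ as above and every constant $C_{\rm cq}$: if the CQ satisfies $$\|(u(t_n)-(K(\partial_t^\tau)g)_n)_n\|_{\ell^2_N}\le C_{\rm cq}\,\tau^k\,\|(g^n)_n\|_{\ell^2_N},$$ then $$\|(u(t_n)-(I_p^{\mathcal T}K(\partial_t^{\tau,\lambda})g)_n)_n\|_{\ell^2_N}\le\Big(C_{\rm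 cq}\,\tau^k+C M_0\max\{\tau^k,\ \tau^{-(\mu+1)}\sqrt{\epsilon_{\rm mach}}\}\Big)\|(g^n)_n\|_{\ell^2_N}.$$ In particular the rate is preserved as long as $\epsilon_{\rm mach}\le\tau^{2(k+\mu+1)}$: the error is then at most $(C_{\rm cq}+CM_0)\,\tau^k\,\|(g^n)_n\|_{\ell^2_N}$. -/

import Mathlib

open MeasureTheory Set

namespace ParsimoniousCQ

noncomputable section

/-! ### Temporal convolutions and convolution quadrature -/

section Convolution

variable {X Y : Type*} [NormedAddCommGroup X] [NormedSpace ℂ X]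
  [NormedAddCommGroup Y] [NormedSpace ℂ Y]

/-- Transfer operators: `K` is analytic on the open right half plane and polynomially bounded
there, `‖K(s)‖ ≤ M₀ |s|^μ`. -/
structure IsTransferFamily (K : ℂ → X →L[ℂ] Y) (μ M₀ : ℝ) : Prop where
  analytic : DifferentiableOn ℂ K {s : ℂ | 0 < s.re}
  bound : ∀ s : ℂ, 0 < s.re → ‖K s‖ ≤ M₀ * ‖s‖ ^ μ

/-- The (one-sided) Laplace transform of `f` at `s`. -/
def laplace {E : Type*} [NormedAddCommGroup E] [NormedSpace ℂ E] (f : ℝ → E) (s : ℂ) : E :=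
  ∫ t in Ioi (0 : ℝ), Complex.exp (-s * (t : ℂ)) • f t

/-- Absolute convergence of the Laplace integral of `f` at `s`. -/
def LaplaceConvergent {E : Type*} [NormedAddCommGroup E] [NormedSpace ℂ E]
    (f : ℝ → E) (s : ℂ) : Prop :=
  IntegrableOn (fun t : ℝ => Complex.exp (-s * (t : ℂ)) • f t) (Ioi (0 : ℝ))

/-- `u = K(∂ₜ) g = (ℒ⁻¹ K) * g` on `[0, ∞)`, for a causal continuous `g`: `u` is the function,
continuous on `[0, ∞)`, whose Laplace transform is `s ↦ K(s) (ℒ g)(s)` on some right half plane.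
(By injectivity of the Laplace transform there is at most one such `u` on `[0, ∞)`.) -/
structure IsTemporalConvolution (K : ℂ → X →L[ℂ] Y) (g : ℝ → X) (u : ℝ → Y) : Prop where
  continuous_data : Continuous g
  causal_data : ∀ t : ℝ, t < 0 → g t = 0
  continuousOn : ContinuousOn u (Ici 0)
  laplace_eq : ∃ σ : ℝ, 0 ≤ σ ∧ ∀ s : ℂ, σ < s.re →
    LaplaceConvergent g s ∧ LaplaceConvergent u s ∧ laplace u s = K s (laplace g s)

/-- Generating function of the implicit Euler method. -/
def eulerDelta (ζ : ℂ) : ℂ := 1 - ζ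

/-- The convolution quadrature weight `W_n(K)`: the coefficient of `ζ ^ n` in the power series of
`ζ ↦ K(δ(ζ)/τ)` at `0`. -/
def cqWeight (δ : ℂ → ℂ) (τ : ℝ) (K : ℂ → X →L[ℂ] Y) (n : ℕ) : X →L[ℂ] Y :=
  ((n.factorial : ℂ))⁻¹ • iteratedDeriv n (fun ζ : ℂ => K (δ ζ / (τ : ℂ))) 0

/-- The convolution quadrature approximation `(K(∂ₜ^τ) g)_n = ∑_{j ≤ n} W_{n-j}(K) g^j`. -/
def cq (δ : ℂ → ℂ) (τ : ℝ) (K : ℂ → X →L[ℂ] Y) (g : ℕ → X) (n : ℕ) : Y :=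
  ∑ j ∈ Finset.range (n + 1), cqWeight δ τ K (n - j) (g j)

/-- The norm `(N⁻¹ ∑_{n=0}^N ‖xⁿ‖²)^{1/2}` of a finite sequence. -/
def discreteNorm {E : Type*} [NormedAddCommGroup E] (N : ℕ) (x : ℕ → E) : ℝ :=
  Real.sqrt ((N : ℝ)⁻¹ * ∑ n ∈ Finset.range (N + 1), ‖x n‖ ^ 2)

end Convolution

/-! ### The mesh -/

/-- The breakpoints `Φ₀, Φ₁, …` for the implicit Euler method, as functions of the number of time
steps `N` and the parameters `ε` and `lam` (the contour radius `λ`). -/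
def meshPoint (N : ℕ) (ε lam : ℝ) : ℕ → ℝ
  | 0 => Real.sqrt (10 * |Real.log ε| / (6 * N))
  | j + 1 =>
    if meshPoint N ε lam j < 1 then
      meshPoint N ε lam j + min (meshPoint N ε lam j)
        (-(8 / 3) * Real.log lam
          - (8 / 3) * Real.log (Real.cos ((7 / 8) * meshPoint N ε lam j)))
    else Real.pi

/-- The index `M = min {j | Φ_j = π}` at which the recursion terminates. -/
def meshIndex (N : ℕ) (ε lam : ℝ) : ℕ := sInf {j : ℕ | meshPoint N ε lam j = Real.pi}

/-- The breakpoints of `[0, π]`, with the initial point `Φ₋₁ = 0` prepended (indices shifted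
by one). -/
def halfBreakpoint (N : ℕ) (ε lam : ℝ) : ℕ → ℝ
  | 0 => 0
  | j + 1 => meshPoint N ε lam j

/-- The `2M + 3` breakpoints of the mesh of `[0, 2π]`, symmetric with respect to `π`: element
number `j` is `[breakpoint j, breakpoint (j+1)]`, for `j = 0, …, 2M + 1`. -/
def breakpoint (N : ℕ) (ε lam : ℝ) (j : ℕ) : ℝ :=
  if j ≤ meshIndex N ε lam + 1 then halfBreakpoint N ε lam j
  else 2 * Real.pi - halfBreakpoint N ε lam (2 * meshIndex N ε lam + 2 - j)

/-- The mesh of `[0, 2π]`, as a set of intervals. -/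
def mesh (N : ℕ) (ε lam : ℝ) : Set (Set ℝ) :=
  {I | ∃ j : ℕ, j ≤ 2 * meshIndex N ε lam + 1 ∧
    I = Icc (breakpoint N ε lam j) (breakpoint N ε lam (j + 1))}

/-- The index of the element that contains `x ∈ [0, 2π]` (the left one, if `x` is a breakpoint). -/
def elementIndex (N : ℕ) (ε lam : ℝ) (x : ℝ) : ℕ :=
  sInf {j : ℕ | x ≤ breakpoint N ε lam (j + 1)}

/-- The first and the last element, on which nothing is interpolated. -/
def IsOuterElement (N : ℕ) (ε lam : ℝ) (j : ℕ) : Prop :=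
  j = 0 ∨ j = 2 * meshIndex N ε lam + 1

instance (N : ℕ) (ε lam : ℝ) (j : ℕ) : Decidable (IsOuterElement N ε lam j) :=
  inferInstanceAs (Decidable (j = 0 ∨ j = 2 * meshIndex N ε lam + 1))

/-! ### Piecewise Chebyshev interpolation -/

/-- The `i`-th of the `p + 1` Chebyshev points, transformed affinely to `[a, b]`. -/
def chebNode (a b : ℝ) (p : ℕ) (i : Fin (p + 1)) : ℝ :=
  a + (b - a) * ((Real.cos ((2 * (i : ℕ) + 1) / (2 * p + 2) * Real.pi) + 1) / 2)

/-- Chebyshev interpolation of degree `p` on `[a, b]`, evaluated at `x` (Lagrange form). -/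
def chebInterp {E : Type*} [NormedAddCommGroup E] [NormedSpace ℂ E]
    (a b : ℝ) (p : ℕ) (f : ℝ → E) (x : ℝ) : E :=
  ∑ i : Fin (p + 1),
    (((Lagrange.basis Finset.univ (chebNode a b p) i).eval x : ℝ) : ℂ) • f (chebNode a b p i)

/-- The elementwise interpolation operator `I_p^𝒯`: the identity on the first and the last
element, Chebyshev interpolation of degree `p` on the others. -/
def meshInterp {E : Type*} [NormedAddCommGroup E] [NormedSpace ℂ E]
    (N : ℕ) (ε lam : ℝ) (p : ℕ) (f : ℝ → E) (x : ℝ) : E :=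
  if IsOuterElement N ε lam (elementIndex N ε lam x) then f x
  else chebInterp (breakpoint N ε lam (elementIndex N ε lam x))
    (breakpoint N ε lam (elementIndex N ε lam x + 1)) p f x

/-! ### Parsimonious convolution quadrature -/

/-- The Laplace domain point `δ(λ e^{iφ}) / τ`. -/
def laplacePoint (δ : ℂ → ℂ) (τ lam φ : ℝ) : ℂ :=
  δ ((lam : ℂ) * Complex.exp (Complex.I * (φ : ℂ))) / (τ : ℂ)

/-- The angle in `(0, 2π]` of `ζ_L^{-l}`, for `0 ≤ l < L`. -/
def sampleAngle (L l : ℕ) : ℝ := 2 * Real.pi - 2 * Real.pi * l / L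

/-- The root of unity `ζ_L = e^{2πi/L}`. -/
def rootOfUnity (L : ℕ) : ℂ := Complex.exp (2 * Real.pi * Complex.I / L)

/-- The parsimonious convolution quadrature approximation
`(λ^{-n}/L) ∑_{l<L} ζ_L^{ln} (I_p^𝒯 K(δ(λ ζ_L^{-l})/τ)) [∑_{j=0}^N λ^j ζ_L^{-jl} g^j]`. -/
def parsimoniousCQ {X Y : Type*} [NormedAddCommGroup X] [NormedSpace ℂ X]
    [NormedAddCommGroup Y] [NormedSpace ℂ Y]
    (δ : ℂ → ℂ) (N L : ℕ) (τ ε lam : ℝ) (p : ℕ) (K : ℂ → X →L[ℂ] Y) (g : ℕ → X) (n : ℕ) : Y :=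
  (((lam : ℂ) ^ n)⁻¹ / (L : ℂ)) • ∑ l ∈ Finset.range L, rootOfUnity L ^ (l * n) •
    (meshInterp N ε lam p (fun φ : ℝ => K (laplacePoint δ τ lam φ)) (sampleAngle L l))
      (∑ j ∈ Finset.range (N + 1), ((lam : ℂ) ^ j * (rootOfUnity L ^ (j * l))⁻¹) • g j)

/-- The list of all Laplace domain points at which the parsimonious convolution quadrature method
evaluates `K`: the samples in the first and the last element, and `p + 1` Chebyshev points for each
of the `2M` other elements. Its length is the number of Laplace domain evaluations. -/
def evaluationPoints (δ : ℂ → ℂ) (N L : ℕ) (τ ε lam : ℝ) (p : ℕ) : List ℂ :=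
  ((List.range L).filter
      (fun l => decide (IsOuterElement N ε lam (elementIndex N ε lam (sampleAngle L l))))).map
    (fun l => laplacePoint δ τ lam (sampleAngle L l)) ++
  (List.range (2 * meshIndex N ε lam)).flatMap (fun j =>
    List.ofFn (fun i : Fin (p + 1) => laplacePoint δ τ lam
      (chebNode (breakpoint N ε lam (j + 1)) (breakpoint N ε lam (j + 2)) p i)))

/-! ### The choice of parameters -/

/-- `ε = max {τ^{2(k+μ+1)}, ε_mach}`. -/
def paramEps (k μ τ εmach : ℝ) : ℝ := max (τ ^ (2 * (k + μ + 1))) εmach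

/-- `p = ⌈- log₂ ε⌉`. -/
def paramDegree (ε : ℝ) : ℕ := ⌈-Real.logb 2 ε⌉₊

/-- `λ = ε^{1/(2N)}`. -/
def paramLambda (N : ℕ) (ε : ℝ) : ℝ := ε ^ (1 / (2 * (N : ℝ)))

end

end ParsimoniousCQ

open ParsimoniousCQ

universe u v

/-! The error is split at two intermediate sequences: the CQ itself, where the assumed rate applies,
and the scaled trapezoidal rule with `N` nodes on the circle of radius `λ`. The two remaining
differences are each a constant times `√ε · B`, where `B` bounds `‖K(s)‖` for `Re s > 0` and `c₁ ≤
|s| ≤ (1 + e²)/τ`. There `B` is of order `M₀ τ^{-(μ+1)}` (`rpow_le_of_le_div`), and `ε` is chosen so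
that `√ε τ^{-(μ+1)}` is exactly the maximum in the claim (`sqrt_paramEps_mul`).

CQ versus trapezoidal rule: the rule returns, besides the `n`-th CQ value, those at `n + N, n + 2N,
…`, damped by `λ^N, λ^{2N}, …`. Plancherel on a larger circle of radius `r`, with `r^{2N} = √ε₀`,
controls all these values in mean square, so the aliasing is of order `λ^N = √ε`
(`sum_norm_sq_aliasing_le`).

Trapezoidal rule versus parsimonious CQ: on an element of length `h`, degree `p` Chebyshev
interpolation has error `7 · 2^{-p} B ≤ 7 ε B` if the integrand is analytic and bounded by `B` on
the ellipse with semi-axes `5h/8` and `3h/8` (`norm_sub_chebInterp_le`). The mesh recursion keeps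
these ellipses where `1 - λ e^{iz}` has positive real part (`isAdmissiblePoint_ellipse`). Discrete
Parseval turns the operator error into an `ℓ²` error, and the scaling `λ^{-n}` costs at most `λ^{-N}
= ε^{-1/2}`, leaving `√ε` (`sum_norm_sq_perturbation_le`).

Only `N` nodes serve `N + 1` data because causality and continuity force `g(0) = 0`: the indices `1,
…, N` are distinct modulo `N`.

Cost: `Φ_{j+1} ≥ Φ_j + Φ_j²` makes `1/Φ_j` drop by at least `1/2` per step, so `1` is reached within
`2/Φ₀ = O(√N)` steps; the outer elements hold `O(N Φ₀) = O(√(N log N))` samples. -/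

/-! ### Chebyshev interpolation of analytic functions -/

/-- The `i`-th of the `p + 1` Chebyshev points of `[-1, 1]`. -/
noncomputable def chebRefNode (p : ℕ) (i : Fin (p + 1)) : ℝ :=
  Real.cos ((2 * (i : ℕ) + 1) / (2 * p + 2) * Real.pi)

theorem chebRefNode_injective (p : ℕ) : Function.Injective (chebRefNode p) := by
  intro i j hij
  have hmem : ∀ k : Fin (p + 1),
      ((2 * (k : ℕ) + 1) / (2 * p + 2) * Real.pi : ℝ) ∈ Icc 0 Real.pi := by
    intro k
    refine ⟨by positivity, ?_⟩
    have hk : ((k : ℕ) : ℝ) ≤ p := by exact_mod_cast Nat.lt_succ_iff.mp k.2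
    have : ((2 * (k : ℕ) + 1) / (2 * p + 2) : ℝ) ≤ 1 := by
      rw [div_le_one (by positivity)]; linarith
    nlinarith [Real.pi_pos]
  have h := Real.injOn_cos (hmem i) (hmem j) hij
  have h2 := mul_right_cancel₀ Real.pi_ne_zero h
  have hp : (2 * (p : ℝ) + 2) ≠ 0 := by positivity
  rw [div_left_inj' hp] at h2
  have : ((i : ℕ) : ℝ) = (j : ℕ) := by linarith
  exact Fin.ext (by exact_mod_cast this)

theorem abs_chebRefNode_le (p : ℕ) (i : Fin (p + 1)) : |chebRefNode p i| ≤ 1 :=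
  Real.abs_cos_le_one _

-- Both sides have degree `p + 1` and leading coefficient `2 ^ p`, so their difference has degree at
-- most `p`; it vanishes at the `p + 1` nodes.
open Polynomial in
theorem chebyshev_T_eq_nodal (p : ℕ) :
    Chebyshev.T ℝ ((p + 1 : ℕ) : ℤ)
      = C (2 ^ p) * Lagrange.nodal Finset.univ (chebRefNode p) := by
  have h2 : (2 : ℝ) ^ p ≠ 0 := by positivity
  refine Polynomial.eq_of_degree_le_of_eval_index_eq (v := chebRefNode p) Finset.univ
    (chebRefNode_injective p).injOn ?_ ?_ ?_ ?_
  · rw [Chebyshev.degree_T, Int.natAbs_natCast]; simp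
  · rw [degree_C_mul h2, Chebyshev.degree_T, Lagrange.degree_nodal, Int.natAbs_natCast]; simp
  · rw [Chebyshev.leadingCoeff_T, leadingCoeff_mul, leadingCoeff_C,
      Lagrange.nodal_monic.leadingCoeff, Int.natAbs_natCast]
    simp
  · intro i hi
    rw [eval_mul, Lagrange.eval_nodal_at_node hi, mul_zero, chebRefNode,
      Chebyshev.T_real_cos, Real.cos_eq_zero_iff]
    refine ⟨i, ?_⟩
    push_cast
    field_simp

/-- The Joukowski map. -/
noncomputable def joukowski (v : ℂ) : ℂ := (v + v⁻¹) / 2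

-- With `v = exp θ` the Joukowski map becomes `cosh θ`, and `T_n (cosh θ) = cosh (n θ)`.
open Polynomial in
theorem eval_T_joukowski (n : ℕ) {v : ℂ} (hv : v ≠ 0) :
    (Chebyshev.T ℂ (n : ℤ)).eval (joukowski v) = (v ^ n + (v ^ n)⁻¹) / 2 := by
  obtain ⟨θ, rfl⟩ : ∃ θ, Complex.exp θ = v := ⟨Complex.log v, Complex.exp_log hv⟩
  have : joukowski (Complex.exp θ) = Complex.cosh θ := by
    rw [joukowski, Complex.cosh, Complex.exp_neg]
  rw [this, Chebyshev.T_complex_cosh, Complex.cosh, Complex.exp_neg, ← Complex.exp_nat_mul]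
  simp

theorem prod_sub_chebRefNode_eq (p : ℕ) (z : ℂ) :
    ∏ i : Fin (p + 1), (z - chebRefNode p i)
      = ((Polynomial.Chebyshev.T ℂ ((p + 1 : ℕ) : ℤ)).eval z) / 2 ^ p := by
  have h := congrArg (fun q => (q.map (algebraMap ℝ ℂ)).eval z) (chebyshev_T_eq_nodal p)
  simp only [Polynomial.Chebyshev.map_T, Polynomial.map_mul, Polynomial.eval_mul,
    Lagrange.nodal, Polynomial.map_prod, Polynomial.eval_prod] at h
  rw [h]
  simp

theorem norm_prod_sub_chebRefNode_le (p : ℕ) {x : ℝ} (hx : |x| ≤ 1) :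
    ‖∏ i : Fin (p + 1), ((x : ℂ) - chebRefNode p i)‖ ≤ 1 / 2 ^ p := by
  rw [prod_sub_chebRefNode_eq, norm_div, norm_pow, Complex.norm_ofNat,
    ← Polynomial.Chebyshev.complex_ofReal_eval_T, Complex.norm_real]
  gcongr
  exact Polynomial.Chebyshev.abs_eval_T_real_le_one _ hx

/-- On the ellipse `|T_{p+1}| ≥ (2^{p+1} - 2^{-(p+1)}) / 2`; division by `2^p` leaves `1 -
4^{-(p+1)} ≥ 3/4`. Against the bound `2^{-p}` on `[-1, 1]` this is the source of the convergence
factor. -/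
theorem le_norm_prod_sub_chebRefNode (p : ℕ) {v : ℂ} (hv : ‖v‖ = 2) :
    3 / 4 ≤ ‖∏ i : Fin (p + 1), (joukowski v - chebRefNode p i)‖ := by
  have hv0 : v ≠ 0 := by rintro rfl; simp at hv
  rw [prod_sub_chebRefNode_eq, norm_div, norm_pow, Complex.norm_ofNat, eval_T_joukowski _ hv0,
    le_div_iff₀ (by positivity), norm_div, Complex.norm_ofNat, le_div_iff₀ (by norm_num)]
  have h1 : ‖v ^ (p + 1)‖ - ‖(v ^ (p + 1))⁻¹‖ ≤ ‖v ^ (p + 1) + (v ^ (p + 1))⁻¹‖ := by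
    have := norm_sub_norm_le (v ^ (p + 1)) (-(v ^ (p + 1))⁻¹)
    rwa [norm_neg, sub_neg_eq_add] at this
  refine le_trans ?_ h1
  rw [norm_inv, norm_pow, hv]
  have h2 : (1 : ℝ) ≤ 2 ^ p := one_le_pow₀ (by norm_num)
  have h3 : ((2 : ℝ) ^ (p + 1))⁻¹ ≤ 2⁻¹ := by
    rw [pow_succ]
    exact inv_anti₀ (by norm_num) (by linarith)
  rw [pow_succ] at h3 ⊢
  linarith

/-- Error of Lagrange interpolation of the Cauchy kernel. -/
theorem inv_sub_sum_basis_mul_inv {F ι : Type*} [Field F] [Fintype ι] [DecidableEq ι] [Nonempty ι]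
    {c : ι → F} (hc : Function.Injective c) {x z : F} (hzx : z ≠ x) (hz : ∀ i, z ≠ c i) :
    (z - x)⁻¹ - ∑ i, (Lagrange.basis Finset.univ c i).eval x * (z - c i)⁻¹
      = (∏ i, (x - c i)) / (∏ i, (z - c i)) * (z - x)⁻¹ := by
  by_cases hx : ∃ j, x = c j
  · obtain ⟨j, rfl⟩ := hx
    rw [Finset.prod_eq_zero (Finset.mem_univ j) (sub_self _), zero_div, zero_mul, sub_eq_zero,
      Finset.sum_eq_single j]
    · rw [Lagrange.eval_basis_self hc.injOn (Finset.mem_univ j), one_mul]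
    · intro i _ hij
      rw [Lagrange.eval_basis_of_ne hij (Finset.mem_univ j), zero_mul]
    · simp
  push Not at hx
  -- Barycentric form of the interpolant of the constant `1`, used below at `x` and at `z`.
  have key : ∀ y, (∀ i, y ≠ c i) → (∏ i, (y - c i)) *
      ∑ i, Lagrange.nodalWeight Finset.univ c i * (y - c i)⁻¹ = 1 := by
    intro y hy
    have := Lagrange.eval_interpolate_not_at_node (s := Finset.univ) (v := c) (x := y) 1
      (fun i _ => hy i)
    rw [Lagrange.interpolate_one hc.injOn Finset.univ_nonempty, Lagrange.eval_nodal] at this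
    simpa using this.symm
  have hPx : ∏ i, (x - c i) ≠ 0 := left_ne_zero_of_mul_eq_one (key x hx)
  have hPz : ∏ i, (z - c i) ≠ 0 := left_ne_zero_of_mul_eq_one (key z hz)
  have hsub : z - x ≠ 0 := sub_ne_zero.mpr hzx
  have hsum : ∑ i, (Lagrange.basis Finset.univ c i).eval x * (z - c i)⁻¹
      = (∏ i, (x - c i)) * (z - x)⁻¹ *
        (∑ i, Lagrange.nodalWeight Finset.univ c i * (x - c i)⁻¹
          - ∑ i, Lagrange.nodalWeight Finset.univ c i * (z - c i)⁻¹) := by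
    rw [← Finset.sum_sub_distrib, Finset.mul_sum]
    refine Finset.sum_congr rfl fun i _ => ?_
    rw [Lagrange.eval_basis_not_at_node (Finset.mem_univ i) (hx i), Lagrange.eval_nodal]
    have h1 : x - c i ≠ 0 := sub_ne_zero.mpr (hx i)
    have h2 : z - c i ≠ 0 := sub_ne_zero.mpr (hz i)
    field_simp
    ring
  rw [hsum, eq_inv_of_mul_eq_one_right (key x hx), eq_inv_of_mul_eq_one_right (key z hz)]
  field_simp
  ring

/-! ### Cauchy's formula on an ellipse, pulled back by the Joukowski map -/

theorem joukowski_differentiableAt {v : ℂ} (hv : v ≠ 0) : DifferentiableAt ℂ joukowski v := by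
  unfold joukowski
  fun_prop (disch := assumption)

theorem joukowski_sub_eq {v w : ℂ} (hv : v ≠ 0) (hw : w ≠ 0) :
    joukowski v - joukowski w = (v - w) * (v - w⁻¹) / (2 * v) := by
  unfold joukowski
  field_simp
  ring

theorem exists_joukowski_eq {x : ℝ} (hx : |x| ≤ 1) : ∃ w : ℂ, ‖w‖ = 1 ∧ joukowski w = x := by
  refine ⟨Complex.exp (Real.arccos x * Complex.I), Complex.norm_exp_ofReal_mul_I _, ?_⟩
  rw [joukowski, ← Complex.exp_neg, ← neg_mul, ← Complex.cos, ← Complex.ofReal_cos,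
    Real.cos_arccos (abs_le.mp hx).1 (abs_le.mp hx).2]

/-- Both preimages `w`, `w⁻¹` of `x` lie on the unit circle, at distance at least `1` from `v`; the
factorisation divides by `2 |v| = 4`. -/
theorem quarter_le_norm_joukowski_sub {v : ℂ} (hv : ‖v‖ = 2) {x : ℝ} (hx : |x| ≤ 1) :
    1 / 4 ≤ ‖joukowski v - x‖ := by
  obtain ⟨w, hw, hwx⟩ := exists_joukowski_eq hx
  have hv0 : v ≠ 0 := by rintro rfl; simp at hv
  have hw0 : w ≠ 0 := by rintro rfl; simp at hw
  rw [← hwx, joukowski_sub_eq hv0 hw0, norm_div, norm_mul, norm_mul, hv, Complex.norm_ofNat]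
  have h1 : 1 ≤ ‖v - w‖ := by
    have := norm_sub_norm_le v w
    linarith
  have h2 : 1 ≤ ‖v - w⁻¹‖ := by
    have := norm_sub_norm_le v w⁻¹
    rw [norm_inv, hw] at this
    linarith
  have : 1 ≤ ‖v - w‖ * ‖v - w⁻¹‖ := one_le_mul_of_one_le_of_one_le h1 h2
  linarith

/-- The derivative of the Joukowski map. -/
noncomputable def joukowskiDeriv (v : ℂ) : ℂ := (1 - (v ^ 2)⁻¹) / 2

theorem continuousOn_joukowski_sphere : ContinuousOn joukowski (Metric.sphere 0 2) := by
  intro v hv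
  have hv0 : v ≠ 0 := by rintro rfl; simp at hv
  exact (joukowski_differentiableAt hv0).continuousAt.continuousWithinAt

theorem continuousOn_joukowskiDeriv_sphere :
    ContinuousOn joukowskiDeriv (Metric.sphere 0 2) := by
  intro v hv
  have hv0 : v ≠ 0 := by rintro rfl; simp at hv
  have : v ^ 2 ≠ 0 := pow_ne_zero _ hv0
  unfold joukowskiDeriv
  fun_prop (disch := assumption)

theorem joukowski_sub_ne_zero {v : ℂ} (hv : ‖v‖ = 2) {x : ℝ} (hx : |x| ≤ 1) :
    joukowski v - x ≠ 0 := by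
  have := quarter_le_norm_joukowski_sub hv hx
  rw [← norm_pos_iff]
  linarith

theorem continuousOn_joukowski_kernel {x : ℝ} (hx : |x| ≤ 1) :
    ContinuousOn (fun v => joukowskiDeriv v * (joukowski v - x)⁻¹) (Metric.sphere 0 2) :=
  continuousOn_joukowskiDeriv_sphere.mul
    ((continuousOn_joukowski_sphere.sub continuousOn_const).inv₀
      fun v hv => joukowski_sub_ne_zero (by simpa using hv) hx)

/-- The logarithmic derivative of `J(v) - x = (v - w)(v - w⁻¹)/(2v)` is `1/(v-w) + 1/(v-w⁻¹) - 1/v`;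
all three poles are enclosed and contribute `1 + 1 - 1`. -/
theorem circleIntegral_joukowski_kernel {x : ℝ} (hx : |x| ≤ 1) :
    (∮ v in C(0, 2), joukowskiDeriv v * (joukowski v - x)⁻¹) = 2 * Real.pi * Complex.I := by
  obtain ⟨w, hw, hwx⟩ := exists_joukowski_eq hx
  have hw0 : w ≠ 0 := by rintro rfl; simp at hw
  have hint : ∀ a : ℂ, ‖a‖ ≤ 1 → CircleIntegrable (fun v => (v - a)⁻¹) 0 2 := by
    intro a ha
    refine ContinuousOn.circleIntegrable (by norm_num) ?_
    refine (continuousOn_id.sub continuousOn_const).inv₀ fun v hv h => ?_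
    have : v = a := sub_eq_zero.mp h
    rw [mem_sphere_zero_iff_norm, this] at hv
    linarith
  have hval : ∀ a : ℂ, ‖a‖ ≤ 1 → (∮ v in C(0, 2), (v - a)⁻¹) = 2 * Real.pi * Complex.I := by
    intro a ha
    refine circleIntegral.integral_sub_inv_of_mem_ball ?_
    rw [mem_ball_zero_iff]; linarith
  have hw' : ‖w⁻¹‖ ≤ 1 := by rw [norm_inv, hw, inv_one]
  calc (∮ v in C(0, 2), joukowskiDeriv v * (joukowski v - x)⁻¹)
      = ∮ v in C(0, 2), ((v - w)⁻¹ + (v - w⁻¹)⁻¹ - (v - 0)⁻¹) := by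
        refine circleIntegral.integral_congr (by norm_num) fun v hv => ?_
        have hv2 : ‖v‖ = 2 := by simpa using hv
        have hv0 : v ≠ 0 := by rintro rfl; simp at hv2
        have hne := joukowski_sub_ne_zero hv2 hx
        rw [← hwx, joukowski_sub_eq hv0 hw0] at hne
        have h1 : v - w ≠ 0 := by rintro h; simp [h] at hne
        have h2 : v - w⁻¹ ≠ 0 := by rintro h; simp [h] at hne
        have h3 : v * w - 1 ≠ 0 := by
          rintro h; apply h2; field_simp; linear_combination h
        simp only [sub_zero]
        rw [← hwx, joukowski_sub_eq hv0 hw0, joukowskiDeriv]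
        field_simp
        ring
    _ = 2 * Real.pi * Complex.I := by
        have hadd : CircleIntegrable (fun v => (v - w)⁻¹ + (v - w⁻¹)⁻¹) 0 2 :=
          (hint w hw.le).add (hint _ hw')
        rw [circleIntegral.integral_sub hadd (hint 0 (by simp)),
          circleIntegral.integral_add (hint w hw.le) (hint _ hw'), hval w hw.le, hval _ hw',
          hval 0 (by simp)]
        ring

variable {E : Type*} [NormedAddCommGroup E] [NormedSpace ℂ E] [CompleteSpace E] in
/-- Cauchy's integral formula on an ellipse with foci `±1`. -/
theorem circleIntegral_joukowski {U : Set ℂ} (hU : IsOpen U) {f : ℂ → E}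
    (hf : DifferentiableOn ℂ f U) (hJ : ∀ v : ℂ, 1 ≤ ‖v‖ → ‖v‖ ≤ 2 → joukowski v ∈ U)
    {x : ℝ} (hx : |x| ≤ 1) :
    (∮ v in C(0, 2), (joukowskiDeriv v * (joukowski v - x)⁻¹) • f (joukowski v))
      = (2 * Real.pi * Complex.I) • f x := by
  obtain ⟨w, hw, hwx⟩ := exists_joukowski_eq hx
  have hxU : (x : ℂ) ∈ U := hwx ▸ hJ w hw.ge (by linarith)
  -- The difference quotient has a removable singularity at `x`, so it suffices that its integral
  -- over the ellipse vanishes.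
  set D : ℂ → E := dslope f x
  have hD : DifferentiableOn ℂ D U :=
    (Complex.differentiableOn_dslope (hU.mem_nhds hxU)).mpr hf
  have hdiff : ∀ v : ℂ, 1 ≤ ‖v‖ → ‖v‖ ≤ 2 →
      DifferentiableAt ℂ (fun v => joukowskiDeriv v • D (joukowski v)) v := by
    intro v h1 h2
    have hv0 : v ≠ 0 := by rintro rfl; norm_num at h1
    have hv2 : v ^ 2 ≠ 0 := pow_ne_zero _ hv0
    have hDv : DifferentiableAt ℂ D (joukowski v) :=
      hD.differentiableAt (hU.mem_nhds (hJ v h1 h2))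
    have hd : DifferentiableAt ℂ joukowskiDeriv v := by
      unfold joukowskiDeriv
      fun_prop (disch := assumption)
    exact hd.smul (hDv.comp v (joukowski_differentiableAt hv0))
  -- Between the two circles `J` stays in `U`, so the contour shrinks to the unit circle, where `J`
  -- folds onto `[-1, 1]`.
  have hann : (∮ v in C(0, 2), joukowskiDeriv v • D (joukowski v))
      = ∮ v in C(0, 1), joukowskiDeriv v • D (joukowski v) := by
    refine Complex.circleIntegral_eq_of_differentiable_on_annulus_off_countable
      (by norm_num) (by norm_num) countable_empty (fun v hv => ?_) (fun v hv => ?_)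
    · have h1 : ‖v‖ ≤ 2 := by simpa using hv.1
      have h2 : 1 ≤ ‖v‖ := by simpa using hv.2
      exact (hdiff v h2 h1).continuousAt.continuousWithinAt
    · have h1 : ‖v‖ < 2 := by simpa using hv.1.1
      have h2 : 1 < ‖v‖ := by simpa using hv.1.2
      exact hdiff v h2.le h1.le
  have hunit : (∮ v in C(0, 1), joukowskiDeriv v • D (joukowski v)) = 0 := by
    have hG : (∮ v in C(0, 1), joukowskiDeriv v • D (joukowski v))
        = ∫ θ in (0 : ℝ)..2 * Real.pi, (-Complex.sin θ) • D (Complex.cos θ) := by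
      rw [circleIntegral]
      refine intervalIntegral.integral_congr fun θ _ => ?_
      simp only [deriv_circleMap, smul_smul]
      have hexp : Complex.exp (θ * Complex.I) ≠ 0 := Complex.exp_ne_zero _
      have hc : circleMap 0 1 θ = Complex.exp (θ * Complex.I) := by simp [circleMap]
      congr 1
      · rw [hc, joukowskiDeriv, Complex.sin, neg_mul, Complex.exp_neg]
        field_simp
        ring
      · rw [hc, joukowski, Complex.cos, neg_mul, Complex.exp_neg]
    rw [hG]
    set I := ∫ θ in (0 : ℝ)..2 * Real.pi, (-Complex.sin θ) • D (Complex.cos θ) with hI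
    -- The folded segment is run through once in each direction: the integrand is odd under `θ ↦ 2π
    -- - θ`.
    have hneg : I = -I := by
      have := intervalIntegral.integral_comp_sub_left (a := 0) (b := 2 * Real.pi)
        (fun θ : ℝ => (-Complex.sin θ) • D (Complex.cos θ)) (2 * Real.pi)
      rw [sub_self, sub_zero, ← hI] at this
      rw [← this, ← intervalIntegral.integral_neg, this, hI]
      refine (intervalIntegral.integral_congr fun θ _ => ?_).symm
      simp only [Complex.ofReal_sub, Complex.ofReal_mul, Complex.ofReal_ofNat]
      rw [Complex.sin_two_pi_sub, Complex.cos_two_pi_sub]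
      simp
    have : (2 : ℂ) • I = 0 := by rw [two_smul]; nth_rewrite 1 [hneg]; simp
    exact (smul_eq_zero.mp this).resolve_left two_ne_zero
  have hker : ContinuousOn (fun v => joukowskiDeriv v * (joukowski v - x)⁻¹)
      (Metric.sphere 0 2) := continuousOn_joukowski_kernel hx
  have hfJ : ContinuousOn (fun v => f (joukowski v)) (Metric.sphere 0 2) :=
    hf.continuousOn.comp continuousOn_joukowski_sphere fun v hv => by
      have : ‖v‖ = 2 := by simpa using hv
      exact hJ v (by linarith) this.le
  have hsplit : (∮ v in C(0, 2), joukowskiDeriv v • D (joukowski v))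
      = (∮ v in C(0, 2), (joukowskiDeriv v * (joukowski v - x)⁻¹) • f (joukowski v))
        - ∮ v in C(0, 2), (joukowskiDeriv v * (joukowski v - x)⁻¹) • f x := by
    rw [← circleIntegral.integral_sub]
    · refine circleIntegral.integral_congr (by norm_num) fun v hv => ?_
      have hne := joukowski_sub_ne_zero (v := v) (by simpa using hv) hx
      simp only [D]
      rw [dslope_of_ne _ (sub_ne_zero.mp hne), slope, vsub_eq_sub, smul_smul, smul_sub]
    · exact (hker.smul hfJ).circleIntegrable (by norm_num)
    · exact (hker.smul continuousOn_const).circleIntegrable (by norm_num)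
  rw [hann, hunit, circleIntegral.integral_smul_const, circleIntegral_joukowski_kernel hx] at hsplit
  exact (sub_eq_zero.mp hsplit.symm)

theorem norm_joukowskiDeriv_le {v : ℂ} (hv : ‖v‖ = 2) : ‖joukowskiDeriv v‖ ≤ 5 / 8 := by
  rw [joukowskiDeriv, norm_div, Complex.norm_ofNat]
  have := norm_sub_le (1 : ℂ) (v ^ 2)⁻¹
  rw [norm_inv, norm_pow, hv, norm_one] at this
  linarith

theorem eval_basis_ofReal {ι : Type*} [Fintype ι] [DecidableEq ι] (c : ι → ℝ) (i : ι) (x : ℝ) :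
    (((Lagrange.basis Finset.univ c i).eval x : ℝ) : ℂ)
      = (Lagrange.basis Finset.univ (fun j => (c j : ℂ)) i).eval (x : ℂ) := by
  simp [Lagrange.basis, Lagrange.basisDivisor, Polynomial.eval_prod]

/-! ### Interpolation error on the reference interval and on `[a, b]` -/

section InterpolationError

variable {E : Type*} [NormedAddCommGroup E] [NormedSpace ℂ E]

/-- Cauchy's formula at `x` and at every node turns the error into one contour integral, whose
kernel error is the ratio of the nodal polynomial at `x` to its value on the ellipse, times the
Cauchy kernel. -/
theorem norm_sub_chebRef_interp_le [CompleteSpace E] {U : Set ℂ} (hU : IsOpen U) {f : ℂ → E}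
    (hf : DifferentiableOn ℂ f U) (hJ : ∀ v : ℂ, 1 ≤ ‖v‖ → ‖v‖ ≤ 2 → joukowski v ∈ U)
    {B : ℝ} (hB : ∀ v : ℂ, ‖v‖ = 2 → ‖f (joukowski v)‖ ≤ B) (p : ℕ) {x : ℝ} (hx : |x| ≤ 1) :
    ‖f x - ∑ i : Fin (p + 1),
        (((Lagrange.basis Finset.univ (chebRefNode p) i).eval x : ℝ) : ℂ) • f (chebRefNode p i)‖
      ≤ 7 / 2 ^ p * B := by
  have hB0 : 0 ≤ B := (norm_nonneg _).trans (hB 2 (by simp))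
  set c : Fin (p + 1) → ℂ := fun i => (chebRefNode p i : ℂ) with hc
  have hcinj : Function.Injective c :=
    Complex.ofReal_injective.comp (chebRefNode_injective p)
  set ℓ : Fin (p + 1) → ℂ := fun i =>
    (((Lagrange.basis Finset.univ (chebRefNode p) i).eval x : ℝ) : ℂ) with hℓ
  have hfJ : ContinuousOn (fun v => f (joukowski v)) (Metric.sphere 0 2) :=
    hf.continuousOn.comp continuousOn_joukowski_sphere fun v hv => by
      have : ‖v‖ = 2 := by simpa using hv
      exact hJ v (by linarith) this.le
  set k : ℝ → ℂ → E := fun y v => (joukowskiDeriv v * (joukowski v - y)⁻¹) • f (joukowski v)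
    with hk
  have hkint : ∀ y : ℝ, |y| ≤ 1 → CircleIntegrable (k y) 0 2 := fun y hy =>
    ((continuousOn_joukowski_kernel hy).smul hfJ).circleIntegrable (by norm_num)
  have hsint : ∀ i, CircleIntegrable (fun v => ℓ i • k (chebRefNode p i) v) 0 2 := fun i =>
    (((continuousOn_joukowski_kernel (abs_chebRefNode_le p i)).smul hfJ).const_smul
      (ℓ i)).circleIntegrable (by norm_num)
  have hrep : (2 * Real.pi * Complex.I) • (f x - ∑ i, ℓ i • f (chebRefNode p i))
      = ∮ v in C(0, 2), (k x v - ∑ i, ℓ i • k (chebRefNode p i) v) := by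
    rw [circleIntegral.integral_sub (hkint x hx), circleIntegral.integral_fun_sum]
    · simp_rw [circleIntegral.integral_smul]
      rw [smul_sub, circleIntegral_joukowski hU hf hJ hx, Finset.smul_sum]
      congr 1
      refine Finset.sum_congr rfl fun i _ => ?_
      rw [circleIntegral_joukowski hU hf hJ (abs_chebRefNode_le p i), smul_comm]
    · exact fun i _ => hsint i
    · exact CircleIntegrable.fun_sum _ fun i _ => hsint i
  have hbound : ∀ v ∈ Metric.sphere (0 : ℂ) 2,
      ‖k x v - ∑ i, ℓ i • k (chebRefNode p i) v‖ ≤ 7 / 2 * (1 / 2 ^ p * B) := by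
    intro v hv
    have hv2 : ‖v‖ = 2 := by simpa using hv
    have hne : ∀ {y : ℝ}, |y| ≤ 1 → joukowski v ≠ y := fun hy =>
      sub_ne_zero.mp (joukowski_sub_ne_zero hv2 hy)
    have hfac : k x v - ∑ i, ℓ i • k (chebRefNode p i) v
        = (joukowskiDeriv v * ((∏ i, ((x : ℂ) - c i)) / (∏ i, (joukowski v - c i))
            * (joukowski v - x)⁻¹)) • f (joukowski v) := by
      rw [← inv_sub_sum_basis_mul_inv hcinj (hne hx) (fun i => hne (abs_chebRefNode_le p i)),
        mul_sub, sub_smul, Finset.mul_sum, Finset.sum_smul]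
      congr 1
      refine Finset.sum_congr rfl fun i _ => ?_
      simp only [hk, hℓ, smul_smul, hc, eval_basis_ofReal]
      congr 1
      ring
    rw [hfac, norm_smul, norm_mul, norm_mul, norm_div, norm_inv]
    have h1 := norm_joukowskiDeriv_le hv2
    have h2 := norm_prod_sub_chebRefNode_le p hx
    have h3 := le_norm_prod_sub_chebRefNode p hv2
    have h4 := quarter_le_norm_joukowski_sub hv2 hx
    have h5 : ‖joukowski v - x‖⁻¹ ≤ 4 := by
      rw [inv_le_comm₀ (by linarith) (by norm_num)]; linarith
    have h6 : ‖∏ i, ((x : ℂ) - c i)‖ / ‖∏ i, (joukowski v - c i)‖ ≤ (1 / 2 ^ p) / (3 / 4) :=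
      div_le_div₀ (by positivity) h2 (by norm_num) h3
    -- The product is `10/3 · 2^{-p} B`, rounded up to `7/2`; the radius `2` of the circle doubles
    -- this to `7`.
    calc _ ≤ 5 / 8 * ((1 / 2 ^ p) / (3 / 4) * 4) * B := by
          gcongr
          exact hB v hv2
      _ ≤ 7 / 2 * (1 / 2 ^ p * B) := by
          have : 0 ≤ 1 / 2 ^ p * B := by positivity
          nlinarith
  have hnorm := circleIntegral.norm_integral_le_of_norm_le_const (by norm_num) hbound
  rw [← hrep, norm_smul] at hnorm
  have hpi : ‖(2 * Real.pi * Complex.I : ℂ)‖ = 2 * Real.pi := by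
    simp [abs_of_pos Real.pi_pos]
  rw [hpi] at hnorm
  have h2pi : 0 < 2 * Real.pi := by positivity
  refine le_of_mul_le_mul_left (hnorm.trans (le_of_eq ?_)) h2pi
  ring

theorem chebNode_eq (a b : ℝ) (p : ℕ) (i : Fin (p + 1)) :
    chebNode a b p i = (a + b) / 2 + (b - a) / 2 * chebRefNode p i := by
  rw [chebNode, chebRefNode]
  ring

theorem chebInterp_eq {a b : ℝ} (hab : a < b) (p : ℕ) (f : ℝ → E) (t : ℝ) :
    chebInterp a b p f ((a + b) / 2 + (b - a) / 2 * t)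
      = ∑ i : Fin (p + 1), (((Lagrange.basis Finset.univ (chebRefNode p) i).eval t : ℝ) : ℂ) •
          f ((a + b) / 2 + (b - a) / 2 * chebRefNode p i) := by
  unfold chebInterp
  refine Finset.sum_congr rfl fun i _ => ?_
  rw [chebNode_eq]
  congr 2
  simp only [Lagrange.basis, Lagrange.basisDivisor, Polynomial.eval_prod, Polynomial.eval_mul,
    Polynomial.eval_C, Polynomial.eval_sub, Polynomial.eval_X, chebNode_eq]
  refine Finset.prod_congr rfl fun j hj => ?_
  have hij : chebRefNode p i - chebRefNode p j ≠ 0 := by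
    rw [sub_ne_zero]
    exact fun h => (Finset.ne_of_mem_erase hj) (chebRefNode_injective p h).symm
  have hba : b - a ≠ 0 := (sub_pos.mpr hab).ne'
  rw [show (a + b) / 2 + (b - a) / 2 * chebRefNode p i
      - ((a + b) / 2 + (b - a) / 2 * chebRefNode p j)
      = (b - a) / 2 * (chebRefNode p i - chebRefNode p j) by ring]
  field_simp
  ring

/-- Chebyshev interpolation of degree `p` converges like `2 ^ (-p)` for functions analytic on the
ellipse with semi-axes `5 h / 8` and `3 h / 8`, where `h = b - a`. -/
theorem norm_sub_chebInterp_le [CompleteSpace E] {U : Set ℂ} (hU : IsOpen U) {f : ℂ → E}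
    (hf : DifferentiableOn ℂ f U) {a b : ℝ} (hab : a < b)
    (hJ : ∀ v : ℂ, 1 ≤ ‖v‖ → ‖v‖ ≤ 2 →
      ((a + b) / 2 : ℝ) + ((b - a) / 2 : ℝ) * joukowski v ∈ U)
    {B : ℝ} (hB : ∀ v : ℂ, ‖v‖ = 2 →
      ‖f (((a + b) / 2 : ℝ) + ((b - a) / 2 : ℝ) * joukowski v)‖ ≤ B)
    (p : ℕ) {x : ℝ} (hx : x ∈ Icc a b) :
    ‖f x - chebInterp a b p (fun y : ℝ => f y) x‖ ≤ 7 / 2 ^ p * B := by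
  set φ : ℂ → ℂ := fun z => ((a + b) / 2 : ℝ) + ((b - a) / 2 : ℝ) * z with hφ
  have hφd : Differentiable ℂ φ := by unfold φ; fun_prop
  have hba : b - a ≠ 0 := (sub_pos.mpr hab).ne'
  obtain ⟨t, ht, rfl⟩ : ∃ t : ℝ, |t| ≤ 1 ∧ (a + b) / 2 + (b - a) / 2 * t = x := by
    refine ⟨(2 * x - a - b) / (b - a), ?_, by field_simp; ring⟩
    have hpos := sub_pos.mpr hab
    rw [abs_le, le_div_iff₀ hpos, div_le_iff₀ hpos]
    constructor <;> linarith [hx.1, hx.2]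
  have := norm_sub_chebRef_interp_le (f := f ∘ φ) (hU.preimage hφd.continuous)
    (hf.comp hφd.differentiableOn fun z hz => hz) hJ hB p ht
  rw [chebInterp_eq hab]
  simpa [hφ, Function.comp_def] using this

end InterpolationError

/-! ### The mesh -/

/-- The function `exp (y²/2) cos y` decreases from `1`, because `y cos y ≤ sin y`, i.e. `y ≤ tan y`.
-/
theorem cos_le_exp_neg_half_sq {x : ℝ} (h0 : 0 ≤ x) (h1 : x ≤ Real.pi / 2) :
    Real.cos x ≤ Real.exp (-(x ^ 2 / 2)) := by
  have hanti : AntitoneOn (fun y => Real.exp (y ^ 2 / 2) * Real.cos y) (Icc 0 (Real.pi / 2)) := by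
    refine antitoneOn_of_deriv_nonpos (convex_Icc _ _) (by fun_prop) (by fun_prop) fun y hy => ?_
    rw [interior_Icc] at hy
    have hd : HasDerivAt (fun y => Real.exp (y ^ 2 / 2) * Real.cos y)
        (Real.exp (y ^ 2 / 2) * (y ^ (2 - 1) * (2 : ℕ) / 2) * Real.cos y
          + Real.exp (y ^ 2 / 2) * (-Real.sin y)) y := by
      refine HasDerivAt.mul (HasDerivAt.exp ?_) (Real.hasDerivAt_cos y)
      simpa [mul_comm] using (hasDerivAt_pow 2 y).div_const 2
    rw [hd.deriv]
    have hc : 0 < Real.cos y :=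
      Real.cos_pos_of_mem_Ioo ⟨by linarith [hy.1, Real.pi_pos], hy.2⟩
    have ht := Real.lt_tan hy.1 hy.2
    rw [Real.tan_eq_sin_div_cos, lt_div_iff₀ hc] at ht
    have he := Real.exp_pos (y ^ 2 / 2)
    have : Real.exp (y ^ 2 / 2) * (y * Real.cos y - Real.sin y) ≤ 0 :=
      mul_nonpos_of_nonneg_of_nonpos he.le (by linarith)
    norm_num
    linarith
  have := hanti (left_mem_Icc.mpr (by positivity)) ⟨h0, h1⟩ h0
  simp only [ne_eq, OfNat.ofNat_ne_zero, not_false_eq_true, zero_pow, zero_div, Real.exp_zero,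
    Real.cos_zero, mul_one] at this
  rw [Real.exp_neg, ← one_div, le_div_iff₀ (Real.exp_pos _), mul_comm]
  exact this

theorem half_sq_le_neg_log_cos {x : ℝ} (h0 : 0 ≤ x) (h1 : x < Real.pi / 2) :
    x ^ 2 / 2 ≤ -Real.log (Real.cos x) := by
  have hc : 0 < Real.cos x := Real.cos_pos_of_mem_Ioo ⟨by linarith [Real.pi_pos], h1⟩
  have := Real.log_le_log hc (cos_le_exp_neg_half_sq h0 h1.le)
  rw [Real.log_exp] at this
  linarith

section MeshPoint

variable {N : ℕ} {ε lam : ℝ}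

theorem meshPoint_succ_of_lt {j : ℕ} (h : meshPoint N ε lam j < 1) :
    meshPoint N ε lam (j + 1) = meshPoint N ε lam j + min (meshPoint N ε lam j)
      (-(8 / 3) * Real.log lam
        - (8 / 3) * Real.log (Real.cos ((7 / 8) * meshPoint N ε lam j))) := by
  rw [meshPoint, if_pos h]

theorem meshPoint_succ_of_le {j : ℕ} (h : 1 ≤ meshPoint N ε lam j) :
    meshPoint N ε lam (j + 1) = Real.pi := by
  rw [meshPoint, if_neg (not_lt.mpr h)]

theorem meshPoint_succ_le {j : ℕ} (h : meshPoint N ε lam j < 1) :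
    meshPoint N ε lam (j + 1) ≤ 2 * meshPoint N ε lam j := by
  rw [meshPoint_succ_of_lt h]
  linarith [min_le_left (meshPoint N ε lam j) (-(8 / 3) * Real.log lam
    - (8 / 3) * Real.log (Real.cos ((7 / 8) * meshPoint N ε lam j)))]

/-- Both entries of the minimum are at least `Φ²`: the first because `Φ < 1`, the second because
`-log cos x ≥ x²/2` at `x = 7Φ/8` gives `(49/48) Φ²` and `-log λ > 0`. -/
theorem add_sq_le_meshPoint_succ (h0 : 0 < lam) (h1 : lam < 1) {j : ℕ}
    (hpos : 0 < meshPoint N ε lam j) (h : meshPoint N ε lam j < 1) :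
    meshPoint N ε lam j + meshPoint N ε lam j ^ 2 ≤ meshPoint N ε lam (j + 1) := by
  rw [meshPoint_succ_of_lt h]
  gcongr
  refine le_min (by nlinarith) ?_
  have hl := Real.log_neg h0 h1
  have := half_sq_le_neg_log_cos (x := (7 / 8) * meshPoint N ε lam j) (by positivity)
    (by linarith [Real.pi_gt_three])
  nlinarith [sq_nonneg (meshPoint N ε lam j)]

theorem meshPoint_pos (h0 : 0 < lam) (h1 : lam < 1) (hpos : 0 < meshPoint N ε lam 0) (j : ℕ) :
    0 < meshPoint N ε lam j := by
  induction j with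
  | zero => exact hpos
  | succ j ih =>
    rcases lt_or_ge (meshPoint N ε lam j) 1 with h | h
    · have := add_sq_le_meshPoint_succ h0 h1 ih h
      nlinarith
    · rw [meshPoint_succ_of_le h]
      exact Real.pi_pos

/-- A discrete form of `Φ' ≥ Φ²`: `1/(x + x²) = 1/x - 1/(1 + x) ≤ 1/x - 1/2` for `x ≤ 1`. -/
theorem inv_meshPoint_le (h0 : 0 < lam) (h1 : lam < 1) (hpos : 0 < meshPoint N ε lam 0) (n : ℕ)
    (hn : ∀ i < n, meshPoint N ε lam i < 1) :
    (meshPoint N ε lam n)⁻¹ ≤ (meshPoint N ε lam 0)⁻¹ - n / 2 := by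
  induction n with
  | zero => simp
  | succ n ih =>
    have h := hn n (Nat.lt_succ_self n)
    have ih := ih fun i hi => hn i (hi.trans (Nat.lt_succ_self n))
    have hp := meshPoint_pos h0 h1 hpos n
    have hstep := add_sq_le_meshPoint_succ h0 h1 hp h
    have : (meshPoint N ε lam (n + 1))⁻¹ ≤ (meshPoint N ε lam n)⁻¹ - 1 / 2 := by
      refine (inv_anti₀ (by positivity) hstep).trans ?_
      generalize meshPoint N ε lam n = x at *
      have e : (x + x ^ 2)⁻¹ = x⁻¹ - (1 + x)⁻¹ := by
        field_simp
        ring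
      rw [e]
      have : (2 : ℝ)⁻¹ ≤ (1 + x)⁻¹ := inv_anti₀ (by positivity) (by linarith)
      linarith
    push_cast
    linarith

/-- The recursion passes `1` after at most `2 / Φ₀` steps and then ends at `π`. -/
theorem exists_meshIndex_eq (h0 : 0 < lam) (h1 : lam < 1) (hpos : 0 < meshPoint N ε lam 0)
    (hlt : meshPoint N ε lam 0 < 1) :
    ∃ m : ℕ, meshIndex N ε lam = m + 1 ∧ (∀ j < m, meshPoint N ε lam j < 1) ∧
      1 ≤ meshPoint N ε lam m ∧ meshPoint N ε lam m < 2 ∧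
      meshPoint N ε lam (m + 1) = Real.pi ∧ (m : ℝ) ≤ 2 / meshPoint N ε lam 0 := by
  have hex : ∃ n, 1 ≤ meshPoint N ε lam n := by
    by_contra! hcon
    obtain ⟨n, hn⟩ := exists_nat_gt (2 * (meshPoint N ε lam 0)⁻¹)
    have := inv_meshPoint_le h0 h1 hpos n fun i _ => hcon i
    have h2 := inv_pos.mpr (meshPoint_pos h0 h1 hpos n)
    linarith
  classical
  set m := Nat.find hex with hm
  have hm1 : 1 ≤ meshPoint N ε lam m := Nat.find_spec hex
  have hmlt : ∀ j < m, meshPoint N ε lam j < 1 := fun j hj => not_le.mp (Nat.find_min hex hj)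
  have hm0 : m ≠ 0 := by rintro h; rw [h] at hm1; linarith
  have hm2 : meshPoint N ε lam m < 2 := by
    obtain ⟨k, hk⟩ := Nat.exists_eq_succ_of_ne_zero hm0
    rw [hk]
    have hk1 := hmlt k (by omega)
    have := meshPoint_succ_le hk1
    simp only [Nat.succ_eq_add_one]
    linarith
  have hpi := meshPoint_succ_of_le hm1
  refine ⟨m, ?_, hmlt, hm1, hm2, hpi, ?_⟩
  · refine le_antisymm (Nat.sInf_le hpi) ?_
    -- No earlier point can equal `π`, since all of them are below `2`.
    refine le_csInf ⟨_, hpi⟩ fun j hj => ?_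
    by_contra! hlt
    have hj' : meshPoint N ε lam j = Real.pi := hj
    have hpi3 := Real.pi_gt_three
    rcases Nat.lt_succ_iff_lt_or_eq.mp hlt with h | h
    · have := hmlt j h
      linarith
    · rw [h] at hj'
      linarith
  · have := inv_meshPoint_le h0 h1 hpos m hmlt
    have h2 := inv_pos.mpr (meshPoint_pos h0 h1 hpos m)
    rw [div_eq_mul_inv]
    linarith

theorem meshPoint_lt_succ (h0 : 0 < lam) (h1 : lam < 1) (hpos : 0 < meshPoint N ε lam 0)
    (hlt : meshPoint N ε lam 0 < 1) {j : ℕ} (hj : j < meshIndex N ε lam) :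
    meshPoint N ε lam j < meshPoint N ε lam (j + 1) := by
  obtain ⟨m, hm, hm1, -, hm2, hpi, -⟩ := exists_meshIndex_eq h0 h1 hpos hlt
  rw [hm] at hj
  rcases Nat.lt_succ_iff_lt_or_eq.mp hj with h | h
  · have hp := meshPoint_pos h0 h1 hpos j
    have := add_sq_le_meshPoint_succ h0 h1 hp (hm1 j h)
    nlinarith
  · rw [h, hpi]
    linarith [Real.pi_gt_three]

theorem meshPoint_meshIndex (h0 : 0 < lam) (h1 : lam < 1) (hpos : 0 < meshPoint N ε lam 0)
    (hlt : meshPoint N ε lam 0 < 1) : meshPoint N ε lam (meshIndex N ε lam) = Real.pi := by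
  obtain ⟨m, hm, -, -, -, hpi, -⟩ := exists_meshIndex_eq h0 h1 hpos hlt
  rw [hm, hpi]

theorem halfBreakpoint_lt_succ (h0 : 0 < lam) (h1 : lam < 1) (hpos : 0 < meshPoint N ε lam 0)
    (hlt : meshPoint N ε lam 0 < 1) {j : ℕ} (hj : j < meshIndex N ε lam + 1) :
    halfBreakpoint N ε lam j < halfBreakpoint N ε lam (j + 1) := by
  cases j with
  | zero => exact hpos
  | succ j => exact meshPoint_lt_succ h0 h1 hpos hlt (by omega)

theorem halfBreakpoint_meshIndex (h0 : 0 < lam) (h1 : lam < 1) (hpos : 0 < meshPoint N ε lam 0)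
    (hlt : meshPoint N ε lam 0 < 1) :
    halfBreakpoint N ε lam (meshIndex N ε lam + 1) = Real.pi :=
  meshPoint_meshIndex h0 h1 hpos hlt

theorem breakpoint_of_le {j : ℕ} (hj : j ≤ meshIndex N ε lam + 1) :
    breakpoint N ε lam j = halfBreakpoint N ε lam j := if_pos hj

/-- The reflected formula also holds at the middle index, where both formulas give `π`. -/
theorem breakpoint_of_ge (h0 : 0 < lam) (h1 : lam < 1) (hpos : 0 < meshPoint N ε lam 0)
    (hlt : meshPoint N ε lam 0 < 1) {j : ℕ} (hj : meshIndex N ε lam + 1 ≤ j) :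
    breakpoint N ε lam j
      = 2 * Real.pi - halfBreakpoint N ε lam (2 * meshIndex N ε lam + 2 - j) := by
  rcases hj.eq_or_lt with rfl | h
  · rw [breakpoint_of_le le_rfl,
      show 2 * meshIndex N ε lam + 2 - (meshIndex N ε lam + 1) = meshIndex N ε lam + 1 by omega,
      halfBreakpoint_meshIndex h0 h1 hpos hlt]
    ring
  · exact if_neg (not_le.mpr h)

theorem breakpoint_last (h0 : 0 < lam) (h1 : lam < 1) (hpos : 0 < meshPoint N ε lam 0)
    (hlt : meshPoint N ε lam 0 < 1) :
    breakpoint N ε lam (2 * meshIndex N ε lam + 2) = 2 * Real.pi := by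
  rw [breakpoint_of_ge h0 h1 hpos hlt (by omega), Nat.sub_self, halfBreakpoint, sub_zero]

theorem breakpoint_lt_succ (h0 : 0 < lam) (h1 : lam < 1) (hpos : 0 < meshPoint N ε lam 0)
    (hlt : meshPoint N ε lam 0 < 1) {j : ℕ} (hj : j < 2 * meshIndex N ε lam + 2) :
    breakpoint N ε lam j < breakpoint N ε lam (j + 1) := by
  rcases lt_or_ge j (meshIndex N ε lam + 1) with h | h
  · rw [breakpoint_of_le h.le, breakpoint_of_le h]
    exact halfBreakpoint_lt_succ h0 h1 hpos hlt h
  · rw [breakpoint_of_ge h0 h1 hpos hlt h, breakpoint_of_ge h0 h1 hpos hlt (by omega)]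
    have := halfBreakpoint_lt_succ h0 h1 hpos hlt
      (j := 2 * meshIndex N ε lam + 2 - (j + 1)) (by omega)
    rw [show 2 * meshIndex N ε lam + 2 - (j + 1) + 1 = 2 * meshIndex N ε lam + 2 - j by omega]
      at this
    linarith

theorem breakpoint_strictMonoOn (h0 : 0 < lam) (h1 : lam < 1) (hpos : 0 < meshPoint N ε lam 0)
    (hlt : meshPoint N ε lam 0 < 1) :
    StrictMonoOn (breakpoint N ε lam) (Iic (2 * meshIndex N ε lam + 2)) :=
  strictMonoOn_Iic_of_lt_succ fun _ hj => by
    rw [Order.succ_eq_add_one]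
    exact breakpoint_lt_succ h0 h1 hpos hlt hj

theorem ncard_mesh (h0 : 0 < lam) (h1 : lam < 1) (hpos : 0 < meshPoint N ε lam 0)
    (hlt : meshPoint N ε lam 0 < 1) : (mesh N ε lam).ncard = 2 * meshIndex N ε lam + 2 := by
  have himage : mesh N ε lam
      = (fun j => Icc (breakpoint N ε lam j) (breakpoint N ε lam (j + 1))) ''
        (Finset.range (2 * meshIndex N ε lam + 2) : Set ℕ) := by
    ext I
    simp only [mesh, mem_ofPred_eq, mem_image, Finset.coe_range, mem_Iio]
    refine exists_congr fun j => ?_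
    rw [eq_comm (a := I), Nat.lt_succ_iff]
  rw [himage, InjOn.ncard_image, ncard_coe_finset, Finset.card_range]
  intro i hi j hj hij
  simp only [Finset.coe_range, mem_Iio] at hi hj
  have hi' := breakpoint_lt_succ h0 h1 hpos hlt hi
  have hj' := breakpoint_lt_succ h0 h1 hpos hlt hj
  have := congrArg sInf hij
  simp only [csInf_Icc hi'.le, csInf_Icc hj'.le] at this
  exact (breakpoint_strictMonoOn h0 h1 hpos hlt).injOn (mem_Iic.mpr hi.le) (mem_Iic.mpr hj.le) this

/-- The last breakpoint `2π` makes the set in `elementIndex` nonempty, so the infimum is attained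
and is not the default `0`. -/
theorem le_breakpoint_elementIndex (h0 : 0 < lam) (h1 : lam < 1)
    (hpos : 0 < meshPoint N ε lam 0) (hlt : meshPoint N ε lam 0 < 1) {x : ℝ}
    (hx : x ≤ 2 * Real.pi) :
    elementIndex N ε lam x ≤ 2 * meshIndex N ε lam + 1 ∧
      x ≤ breakpoint N ε lam (elementIndex N ε lam x + 1) := by
  have hmem : 2 * meshIndex N ε lam + 1 ∈ {j : ℕ | x ≤ breakpoint N ε lam (j + 1)} := by
    rw [mem_ofPred_eq, breakpoint_last h0 h1 hpos hlt]
    exact hx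
  exact ⟨Nat.sInf_le hmem, Nat.sInf_mem ⟨_, hmem⟩⟩

theorem breakpoint_elementIndex_lt {x : ℝ} (hx : elementIndex N ε lam x ≠ 0) :
    breakpoint N ε lam (elementIndex N ε lam x) < x := by
  obtain ⟨k, hk⟩ := Nat.exists_eq_succ_of_ne_zero hx
  have : k ∉ {j : ℕ | x ≤ breakpoint N ε lam (j + 1)} := by
    refine Nat.notMem_of_lt_sInf ?_
    have hk' : sInf {j : ℕ | x ≤ breakpoint N ε lam (j + 1)} = k + 1 := hk
    omega
  rw [hk]
  exact not_le.mp this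

end MeshPoint

/-! ### Ellipses around the elements -/

/-- The circle of radius `r` goes to the ellipse with semi-axes `(r ± 1/r)/2`, which for `1 ≤ r ≤ 2`
are at most `5/4` and `3/4`. -/
theorem sq_re_add_sq_im_joukowski_le {v : ℂ} (h1 : 1 ≤ ‖v‖) (h2 : ‖v‖ ≤ 2) :
    (4 / 5 * (joukowski v).re) ^ 2 + (4 / 3 * (joukowski v).im) ^ 2 ≤ 1 := by
  set r := ‖v‖ with hr
  have hr0 : 0 < r := by linarith
  have hsq : Complex.normSq v = r ^ 2 := by rw [hr, Complex.sq_norm]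
  have hv : v.re ^ 2 + v.im ^ 2 = r ^ 2 := by
    rw [← hsq, Complex.normSq_apply]; ring
  have hre : (joukowski v).re = v.re / r * ((r + 1 / r) / 2) := by
    rw [joukowski, Complex.div_ofNat_re, Complex.add_re, Complex.inv_re, hsq]
    field_simp
  have him : (joukowski v).im = v.im / r * ((r - 1 / r) / 2) := by
    rw [joukowski, Complex.div_ofNat_im, Complex.add_im, Complex.inv_im, hsq]
    field_simp
    ring
  have hone : (v.re / r) ^ 2 + (v.im / r) ^ 2 = 1 := by
    field_simp
    exact hv
  have hinv : 0 < 1 / r := by positivity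
  have hp0 : 0 ≤ 4 / 5 * ((r + 1 / r) / 2) := by positivity
  have hp : 4 / 5 * ((r + 1 / r) / 2) ≤ 1 := by
    have : r + 1 / r ≤ 5 / 2 := by
      rw [← sub_nonneg]
      have : 5 / 2 - (r + 1 / r) = (2 - r) * (r - 1 / 2) / r := by field_simp; ring
      rw [this]
      exact div_nonneg (mul_nonneg (by linarith) (by linarith)) hr0.le
    linarith
  have hinv1 : 1 / r ≤ 1 := by rw [div_le_one hr0]; exact h1
  have hinv2 : 1 / 2 ≤ 1 / r := one_div_le_one_div_of_le hr0 h2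
  have hm0 : 0 ≤ 4 / 3 * ((r - 1 / r) / 2) := by linarith
  have hm : 4 / 3 * ((r - 1 / r) / 2) ≤ 1 := by linarith
  calc (4 / 5 * (joukowski v).re) ^ 2 + (4 / 3 * (joukowski v).im) ^ 2
      = (v.re / r) ^ 2 * (4 / 5 * ((r + 1 / r) / 2)) ^ 2
        + (v.im / r) ^ 2 * (4 / 3 * ((r - 1 / r) / 2)) ^ 2 := by rw [hre, him]; ring
    _ ≤ (v.re / r) ^ 2 * 1 + (v.im / r) ^ 2 * 1 := by
        gcongr
        · exact pow_le_one₀ hp0 hp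
        · exact pow_le_one₀ hm0 hm
    _ = 1 := by rw [mul_one, mul_one, hone]

/-- On the ellipse around an element `[a, a + h]` with `a < 1`. -/
theorem lam_mul_exp_mul_cos_lt_one_of_lt {lam a h c s : ℝ} (hl : 0 < lam) (ha0 : 0 < a)
    (ha1 : a < 1) (hh0 : 0 < h) (hha : h ≤ a)
    (hh : h ≤ -(8 / 3) * Real.log lam - (8 / 3) * Real.log (Real.cos ((7 / 8) * a)))
    (hcs : (4 / 5 * c) ^ 2 + (4 / 3 * s) ^ 2 ≤ 1) :
    lam * Real.exp |h / 2 * s| * Real.cos (a + h / 2 + h / 2 * c) < 1 := by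
  have hpi := Real.pi_gt_three
  have hcos : 0 < Real.cos ((7 / 8) * a) :=
    Real.cos_pos_of_mem_Ioo ⟨by linarith, by linarith⟩
  have hc : |4 / 5 * c| ≤ 1 := by
    rw [← sq_le_one_iff_abs_le_one]; nlinarith [sq_nonneg (4 / 3 * s)]
  rw [abs_le] at hc
  have hs : |4 / 3 * s| ≤ 1 := by
    rw [← sq_le_one_iff_abs_le_one]; nlinarith [sq_nonneg (4 / 5 * c)]
  have habs : |h / 2 * s| = 3 * h / 8 * |4 / 3 * s| := by
    rw [abs_mul, abs_mul, abs_of_pos (by positivity : 0 < h / 2),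
      abs_of_pos (by norm_num : (0 : ℝ) < 4 / 3)]
    ring
  set X := a + h / 2 + h / 2 * c with hX
  -- The ellipse reaches `h/8 ≤ a/8` to the left of `a`: this is the `7/8` of the mesh recursion.
  have hXlow : (7 / 8) * a ≤ X := by nlinarith
  have hXup : X ≤ Real.pi := by nlinarith
  rcases le_or_gt (Real.cos X) 0 with h0 | h0
  · have : 0 < lam * Real.exp |h / 2 * s| := by positivity
    nlinarith
  -- The imaginary part is at most `3h/8`, which explains the factor `8/3` in the recursion.
  -- Equality needs the top or bottom of the ellipse; such a point lies over the centre, strictly to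
  -- the right of `7a/8`, so one of the two estimates is strict.
  have hle : lam * Real.exp |h / 2 * s| ≤ (Real.cos ((7 / 8) * a))⁻¹ ∧
      (lam * Real.exp |h / 2 * s| < (Real.cos ((7 / 8) * a))⁻¹ ∨ (7 / 8) * a < X) := by
    have heq : (Real.cos ((7 / 8) * a))⁻¹
        = lam * Real.exp (-Real.log lam - Real.log (Real.cos ((7 / 8) * a))) := by
      rw [Real.exp_sub, Real.exp_neg, Real.exp_log hl, Real.exp_log hcos]
      field_simp
    rw [heq]
    have hle2 : |h / 2 * s| ≤ -Real.log lam - Real.log (Real.cos ((7 / 8) * a)) := by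
      rw [habs]; nlinarith
    refine ⟨by gcongr, ?_⟩
    rcases hs.lt_or_eq with hs | hs
    · left
      gcongr
      rw [habs]; nlinarith
    · right
      have hs2 : (4 / 3 * s) ^ 2 = 1 := by rw [← sq_abs, hs, one_pow]
      have hc0 : 4 / 5 * c = 0 := by
        have : (4 / 5 * c) ^ 2 ≤ 0 := by linarith
        exact pow_eq_zero_iff (two_ne_zero) |>.mp (le_antisymm this (sq_nonneg _))
      have : c = 0 := by linarith
      rw [hX, this]
      linarith
  have hcosle : Real.cos X ≤ Real.cos ((7 / 8) * a) :=
    Real.cos_le_cos_of_nonneg_of_le_pi (by positivity) hXup hXlow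
  have hone : (Real.cos ((7 / 8) * a))⁻¹ * Real.cos ((7 / 8) * a) = 1 :=
    inv_mul_cancel₀ hcos.ne'
  rcases hle with ⟨hle, hlt | hlt⟩
  · calc _ < (Real.cos ((7 / 8) * a))⁻¹ * Real.cos X := by gcongr
      _ ≤ 1 := by rw [← hone]; gcongr
  · have : Real.cos X < Real.cos ((7 / 8) * a) :=
      Real.cos_lt_cos_of_nonneg_of_le_pi (by positivity) hXup hlt
    calc _ ≤ (Real.cos ((7 / 8) * a))⁻¹ * Real.cos X := by gcongr
      _ < 1 := by rw [← hone]; gcongr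

/-- The numbers approximate `(1+π)/2`, `5(π-1)/8` and `3(π-1)/8`, the data of the element `[1, π]`.
The circle is replaced by its tangents at `(4/5, 3/5)` and `(12/13, 5/13)`, which leaves a quadratic
inequality in `c` on each side of `c = 0.88`. -/
theorem quadratic_ellipse_bound {c s X : ℝ} (hc1 : c ≤ 1)
    (hcs : c ^ 2 + s ^ 2 ≤ 1) (hX : 2.07065 - 1.33845 * c ≤ X) : 0.8031 * s ≤ X ^ 2 / 2 := by
  have h1 : 3 * s ≤ 5 - 4 * c := by nlinarith [sq_nonneg (4 / 5 - c), sq_nonneg (3 / 5 - s)]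
  have h2 : 5 * s ≤ 13 - 12 * c := by
    nlinarith [sq_nonneg (12 / 13 - c), sq_nonneg (5 / 13 - s)]
  have hY : 0 ≤ 2.07065 - 1.33845 * c := by linarith
  have hsq : (2.07065 - 1.33845 * c) ^ 2 ≤ X ^ 2 := by gcongr
  rcases le_or_gt c 0.88 with h | h
  · nlinarith [mul_nonneg (sub_nonneg.mpr h) (sub_nonneg.mpr h)]
  · nlinarith [mul_nonneg (sub_nonneg.mpr h.le) (sub_nonneg.mpr h.le)]

/-- On the ellipse around an element `[a, π]` with `a ≥ 1`. -/
theorem lam_mul_exp_mul_cos_lt_one_of_ge {lam a c s : ℝ} (hl : 0 < lam) (hl1 : lam < 1)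
    (ha1 : 1 ≤ a) (ha2 : a < 2) (hcs : (4 / 5 * c) ^ 2 + (4 / 3 * s) ^ 2 ≤ 1) :
    lam * Real.exp |(Real.pi - a) / 2 * s|
      * Real.cos ((a + Real.pi) / 2 + (Real.pi - a) / 2 * c) < 1 := by
  have hpi1 : 3.1415 < Real.pi := by linarith [Real.pi_gt_d4]
  have hpi2 : Real.pi < 3.1416 := Real.pi_lt_d4
  have hh : 0 < Real.pi - a := by linarith
  have hc : |4 / 5 * c| ≤ 1 := by
    rw [← sq_le_one_iff_abs_le_one]; nlinarith [sq_nonneg (4 / 3 * s)]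
  rw [abs_le] at hc
  set X := (a + Real.pi) / 2 + (Real.pi - a) / 2 * c with hX
  rcases le_or_gt (Real.cos X) 0 with h0 | h0
  · have : 0 < lam * Real.exp |(Real.pi - a) / 2 * s| := by positivity
    nlinarith
  have hXlow : 0 ≤ X := by nlinarith
  have hXup : X ≤ Real.pi + Real.pi / 2 := by nlinarith
  have hXhalf : X < Real.pi / 2 := by
    by_contra! hcon
    exact absurd (Real.cos_nonpos_of_pi_div_two_le_of_le hcon hXup) (not_le.mpr h0)
  set d := -(4 / 5 * c) with hd
  have hd1 : d ≤ 1 := by linarith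
  have hc' : c = -(5 / 4 * d) := by rw [hd]; ring
  have hd0 : 0 ≤ d := by
    by_contra! hcon
    rw [hX, hc'] at hXhalf
    nlinarith
  -- `X` increases with `a`, so `a = 1` is the worst case. The result is affine in `π`, with a slope
  -- that changes sign at `d = 0.8`; hence the two cases, using a lower and an upper bound for `π`.
  have hXd : 2.07065 - 1.33845 * d ≤ X := by
    have hstep : (1 / 2 + 5 * d / 8) + Real.pi * (1 / 2 - 5 * d / 8) ≤ X := by
      rw [hX, hc']
      nlinarith
    rcases le_or_gt d 0.8 with h | h
    · nlinarith
    · nlinarith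
  have hs := quadratic_ellipse_bound (c := d) (s := |4 / 3 * s|) hd1
    (by rw [sq_abs, hd, neg_sq]; exact hcs) hXd
  have habs : |(Real.pi - a) / 2 * s| = 3 * (Real.pi - a) / 8 * |4 / 3 * s| := by
    rw [abs_mul, abs_mul, abs_of_pos (by positivity : 0 < (Real.pi - a) / 2),
      abs_of_pos (by norm_num : (0 : ℝ) < 4 / 3)]
    ring
  have hle : |(Real.pi - a) / 2 * s| ≤ X ^ 2 / 2 := by
    rw [habs]
    have := abs_nonneg (4 / 3 * s)
    nlinarith
  -- The Gaussian bound for the cosine absorbs the exponential growth completely, and the factor `λ`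
  -- gives strictness.
  calc _ ≤ lam * Real.exp (X ^ 2 / 2) * Real.exp (-(X ^ 2 / 2)) := by
        gcongr
        exact cos_le_exp_neg_half_sq hXlow hXhalf.le
    _ = lam := by rw [mul_assoc, ← Real.exp_add, add_neg_cancel, Real.exp_zero, mul_one]
    _ < 1 := hl1

/-! ### Admissible points and the values of `1 - λ e^{iz}` there -/

/-- Points of the strip at which `1 - lam * exp (I z)` has positive real part and is bounded from
below and above. -/
structure IsAdmissiblePoint (θ lam : ℝ) (z : ℂ) : Prop where
  abs_im_le : |z.im| ≤ 2
  le_re : θ ≤ z.re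
  re_le : z.re ≤ 2 * Real.pi - θ
  mul_cos_lt : lam * Real.exp |z.im| * Real.cos z.re < 1

theorem IsAdmissiblePoint.two_pi_sub {θ lam : ℝ} {z : ℂ} (hz : IsAdmissiblePoint θ lam z) :
    IsAdmissiblePoint θ lam (2 * Real.pi - z) := by
  have him : (2 * Real.pi - z : ℂ).im = -z.im := by simp
  have hre : (2 * Real.pi - z : ℂ).re = 2 * Real.pi - z.re := by simp
  constructor
  · rw [him, abs_neg]; exact hz.abs_im_le
  · rw [hre]; linarith [hz.re_le]
  · rw [hre]; linarith [hz.le_re]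
  · rw [him, hre, abs_neg, Real.cos_two_pi_sub]; exact hz.mul_cos_lt

theorem re_lam_mul_exp (lam : ℝ) (z : ℂ) :
    ((lam : ℂ) * Complex.exp (Complex.I * z)).re = lam * Real.exp (-z.im) * Real.cos z.re := by
  rw [Complex.re_ofReal_mul, Complex.exp_re]
  simp [mul_assoc]

theorem norm_lam_mul_exp {lam : ℝ} (hl : 0 < lam) (z : ℂ) :
    ‖(lam : ℂ) * Complex.exp (Complex.I * z)‖ = lam * Real.exp (-z.im) := by
  rw [norm_mul, Complex.norm_exp, Complex.norm_real, Real.norm_of_nonneg hl.le]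
  simp

theorem IsAdmissiblePoint.re_pos {θ lam : ℝ} {z : ℂ} (hl : 0 < lam)
    (hz : IsAdmissiblePoint θ lam z) :
    0 < (1 - (lam : ℂ) * Complex.exp (Complex.I * z)).re := by
  rw [Complex.sub_re, re_lam_mul_exp, Complex.one_re, sub_pos]
  rcases le_or_gt (Real.cos z.re) 0 with h | h
  · have : 0 < lam * Real.exp (-z.im) := by positivity
    nlinarith
  · refine lt_of_le_of_lt ?_ hz.mul_cos_lt
    gcongr
    exact neg_le_abs _

/-- With `w = λ e^{iz}` outside the sector of half-angle `θ` and `r = |w|`, one has `|1 - w|² ≥ 1 -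
2 r cos θ + r² = (r - cos θ)² + sin² θ`. -/
theorem IsAdmissiblePoint.sin_le_norm {θ lam : ℝ} {z : ℂ} (hl : 0 < lam) (hθ0 : 0 ≤ θ)
    (hz : IsAdmissiblePoint θ lam z) :
    Real.sin θ ≤ ‖1 - (lam : ℂ) * Complex.exp (Complex.I * z)‖ := by
  set w := (lam : ℂ) * Complex.exp (Complex.I * z) with hw
  have hcos : Real.cos z.re ≤ Real.cos θ := by
    rcases le_total z.re Real.pi with h | h
    · exact Real.cos_le_cos_of_nonneg_of_le_pi hθ0 h hz.le_re
    · rw [← Real.cos_two_pi_sub]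
      exact Real.cos_le_cos_of_nonneg_of_le_pi hθ0 (by linarith) (by linarith [hz.re_le])
  have hr : 0 < lam * Real.exp (-z.im) := by positivity
  have hsq : ‖w‖ ^ 2 = w.re ^ 2 + w.im ^ 2 := by
    rw [Complex.sq_norm, Complex.normSq_apply]; ring
  have hsq' : ‖1 - w‖ ^ 2 = (1 - w.re) ^ 2 + w.im ^ 2 := by
    rw [Complex.sq_norm, Complex.normSq_apply]; simp; ring
  rw [norm_lam_mul_exp hl] at hsq
  have hre := re_lam_mul_exp lam z
  rw [← hw] at hre
  refine le_of_sq_le_sq ?_ (norm_nonneg _)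
  rw [hsq']
  have h1 := Real.sin_sq_add_cos_sq θ
  generalize lam * Real.exp (-z.im) = r at *
  have h2 : r * Real.cos z.re ≤ r * Real.cos θ := by gcongr
  nlinarith [sq_nonneg (r - Real.cos θ)]

theorem IsAdmissiblePoint.norm_le {θ lam : ℝ} {z : ℂ} (hl : 0 < lam) (hl1 : lam < 1)
    (hz : IsAdmissiblePoint θ lam z) :
    ‖1 - (lam : ℂ) * Complex.exp (Complex.I * z)‖ ≤ 1 + Real.exp 2 := by
  refine (norm_sub_le _ _).trans ?_
  rw [norm_lam_mul_exp hl, norm_one]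
  have : Real.exp (-z.im) ≤ Real.exp 2 := by
    gcongr
    exact (neg_le_abs _).trans hz.abs_im_le
  have := Real.exp_pos (-z.im)
  nlinarith

section MeshEllipses

variable {N : ℕ} {ε lam : ℝ}

theorem isAdmissiblePoint_ellipse_meshPoint (h0 : 0 < lam) (h1 : lam < 1)
    (hpos : 0 < meshPoint N ε lam 0) (hlt : meshPoint N ε lam 0 ≤ 4 / 5) {i : ℕ}
    (hi : i < meshIndex N ε lam) {v : ℂ} (hv1 : 1 ≤ ‖v‖) (hv2 : ‖v‖ ≤ 2) :
    IsAdmissiblePoint (7 / 8 * meshPoint N ε lam 0) lam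
      (((meshPoint N ε lam i + meshPoint N ε lam (i + 1)) / 2 : ℝ)
        + ((meshPoint N ε lam (i + 1) - meshPoint N ε lam i) / 2 : ℝ) * joukowski v) := by
  have hlt1 : meshPoint N ε lam 0 < 1 := by linarith
  obtain ⟨m, hm, hm1, hm2, hm3, hpi, -⟩ := exists_meshIndex_eq h0 h1 hpos hlt1
  have hcs := sq_re_add_sq_im_joukowski_le hv1 hv2
  set c := (joukowski v).re
  set s := (joukowski v).im
  have hpi3 := Real.pi_gt_three
  have hpi4 : Real.pi < 3.15 := Real.pi_lt_d2
  have hai := meshPoint_pos h0 h1 hpos i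
  have hmono := meshPoint_lt_succ h0 h1 hpos hlt1 hi
  have h0i : meshPoint N ε lam 0 ≤ meshPoint N ε lam i :=
    (strictMonoOn_Iic_of_lt_succ (n := meshIndex N ε lam) fun j hj => by
      rw [Order.succ_eq_add_one]
      exact meshPoint_lt_succ h0 h1 hpos hlt1 hj).monotoneOn
        (mem_Iic.mpr (Nat.zero_le _)) (mem_Iic.mpr hi.le) (Nat.zero_le _)
  have hc : |4 / 5 * c| ≤ 1 := by
    rw [← sq_le_one_iff_abs_le_one]; nlinarith [sq_nonneg (4 / 3 * s)]
  have hs : |4 / 3 * s| ≤ 1 := by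
    rw [← sq_le_one_iff_abs_le_one]; nlinarith [sq_nonneg (4 / 5 * c)]
  rw [abs_le] at hc hs
  set a := meshPoint N ε lam i with ha
  set b := meshPoint N ε lam (i + 1) with hb
  have hre : ∀ x y : ℝ, ((x : ℂ) + (y : ℂ) * joukowski v).re = x + y * c := by
    intro x y; simp [c]
  have him : ∀ x y : ℝ, ((x : ℂ) + (y : ℂ) * joukowski v).im = y * s := by
    intro x y; simp [s]
  have hcase : (a < 1 ∧ b ≤ 2 * a) ∨ (1 ≤ a ∧ a < 2 ∧ b = Real.pi) := by
    rw [hm] at hi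
    rcases Nat.lt_succ_iff_lt_or_eq.mp hi with h | h
    · exact Or.inl ⟨hm1 i h, meshPoint_succ_le (hm1 i h)⟩
    · right
      rw [ha, hb, h]
      exact ⟨hm2, hm3, hpi⟩
  -- On the left of the last element, `a - (π - a)/8 ≥ 0.73` while `7Φ₀/8 ≤ 0.7`; this is where `Φ₀
  -- ≤ 4/5` enters.
  have hbounds : b - a ≤ 2.15 ∧ 7 / 8 * meshPoint N ε lam 0 ≤ a - (b - a) / 8
      ∧ b + (b - a) / 8 ≤ 2 * Real.pi - 7 / 8 * meshPoint N ε lam 0 := by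
    rcases hcase with ⟨h2, h3⟩ | ⟨h2, h3, h4⟩
    · refine ⟨?_, ?_, ?_⟩ <;> linarith
    · refine ⟨?_, ?_, ?_⟩ <;> linarith
  have hba : 0 < b - a := sub_pos.mpr hmono
  constructor
  · rw [him, abs_le]
    constructor <;> nlinarith
  · rw [hre]; nlinarith
  · rw [hre]; nlinarith
  · rw [hre, him]
    rcases hcase with ⟨h2, h3⟩ | ⟨h2, h3, h4⟩
    · have := lam_mul_exp_mul_cos_lt_one_of_lt (lam := lam) (a := a) (h := b - a) (c := c) (s := s)
        h0 hai h2 hba (by linarith) ?_ hcs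
      · convert this using 3
        ring
      · rw [hb, meshPoint_succ_of_lt h2, ← ha, add_sub_cancel_left]
        exact min_le_right _ _
    · rw [h4]
      exact lam_mul_exp_mul_cos_lt_one_of_ge h0 h1 h2 h3 hcs

theorem joukowski_neg (v : ℂ) : joukowski (-v) = -joukowski v := by
  rw [joukowski, joukowski, inv_neg]
  ring

/-- The ellipses around the inner elements consist of admissible points. -/
theorem isAdmissiblePoint_ellipse (h0 : 0 < lam) (h1 : lam < 1)
    (hpos : 0 < meshPoint N ε lam 0) (hlt : meshPoint N ε lam 0 ≤ 4 / 5) {j : ℕ}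
    (hj1 : 1 ≤ j) (hj2 : j ≤ 2 * meshIndex N ε lam) {v : ℂ} (hv1 : 1 ≤ ‖v‖) (hv2 : ‖v‖ ≤ 2) :
    IsAdmissiblePoint (7 / 8 * meshPoint N ε lam 0) lam
      (((breakpoint N ε lam j + breakpoint N ε lam (j + 1)) / 2 : ℝ)
        + ((breakpoint N ε lam (j + 1) - breakpoint N ε lam j) / 2 : ℝ) * joukowski v) := by
  have hlt1 : meshPoint N ε lam 0 < 1 := by linarith
  rcases le_or_gt j (meshIndex N ε lam) with h | h
  · rw [breakpoint_of_le (by omega), breakpoint_of_le (by omega)]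
    obtain ⟨i, rfl⟩ := Nat.exists_eq_add_of_le' hj1
    exact isAdmissiblePoint_ellipse_meshPoint h0 h1 hpos hlt (i := i) (by omega) hv1 hv2
  · rw [breakpoint_of_ge h0 h1 hpos hlt1 (by omega), breakpoint_of_ge h0 h1 hpos hlt1 (by omega)]
    obtain ⟨i, hi, hi1, hi2⟩ : ∃ i, i < meshIndex N ε lam ∧
        2 * meshIndex N ε lam + 2 - (j + 1) = i + 1 ∧
        2 * meshIndex N ε lam + 2 - j = (i + 1) + 1 :=
      ⟨2 * meshIndex N ε lam - j, by omega, by omega, by omega⟩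
    rw [hi1, hi2]
    -- The right half of the mesh is the mirror image under `z ↦ 2π - z`, which replaces `J(v)` by
    -- `-J(v) = J(-v)`.
    have := (isAdmissiblePoint_ellipse_meshPoint h0 h1 hpos hlt (v := -v) hi
      (by rwa [norm_neg]) (by rwa [norm_neg])).two_pi_sub
    convert this using 1
    rw [joukowski_neg]
    simp only [halfBreakpoint]
    push_cast
    ring

/-- Error of the piecewise interpolation of `φ ↦ K (δ (λ exp (i φ)) / τ)`. -/
theorem norm_sub_meshInterp_le {E : Type*} [NormedAddCommGroup E] [NormedSpace ℂ E]
    [CompleteSpace E] (h0 : 0 < lam) (h1 : lam < 1)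
    (hpos : 0 < meshPoint N ε lam 0) (hlt : meshPoint N ε lam 0 ≤ 4 / 5) {K : ℂ → E}
    (hK : DifferentiableOn ℂ K {s : ℂ | 0 < s.re}) {τ : ℝ} (hτ : 0 < τ) {B : ℝ} (hB0 : 0 ≤ B)
    (hB : ∀ s : ℂ, 0 < s.re → Real.sin (7 / 8 * meshPoint N ε lam 0) / τ ≤ ‖s‖ →
      ‖s‖ ≤ (1 + Real.exp 2) / τ → ‖K s‖ ≤ B)
    (p : ℕ) {x : ℝ} (hx : x ≤ 2 * Real.pi) :
    ‖K (laplacePoint eulerDelta τ lam x)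
      - meshInterp N ε lam p (fun φ : ℝ => K (laplacePoint eulerDelta τ lam φ)) x‖
      ≤ 7 / 2 ^ p * B := by
  have hlt1 : meshPoint N ε lam 0 < 1 := by linarith
  have hτ' : ‖(τ : ℂ)‖ = τ := by rw [Complex.norm_real, Real.norm_of_nonneg hτ.le]
  unfold meshInterp
  split_ifs with hout
  · rw [sub_self, norm_zero]
    positivity
  · set j := elementIndex N ε lam x with hj
    rw [IsOuterElement, not_or] at hout
    obtain ⟨hj2, hxj⟩ := le_breakpoint_elementIndex h0 h1 hpos hlt1 hx
    have hxj' := breakpoint_elementIndex_lt hout.1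
    set s : ℂ → ℂ := fun z => eulerDelta ((lam : ℂ) * Complex.exp (Complex.I * z)) / (τ : ℂ) with hs
    have hsd : Differentiable ℂ s := by
      unfold s eulerDelta
      fun_prop
    have hsre : ∀ z : ℂ, (s z).re = (1 - (lam : ℂ) * Complex.exp (Complex.I * z)).re / τ := by
      intro z
      simp only [hs, eulerDelta, Complex.div_ofReal_re]
    have hsnorm : ∀ z : ℂ, ‖s z‖ = ‖1 - (lam : ℂ) * Complex.exp (Complex.I * z)‖ / τ := by
      intro z
      simp only [hs, eulerDelta, norm_div, hτ']
    have hadm := fun (v : ℂ) (hv1 : 1 ≤ ‖v‖) (hv2 : ‖v‖ ≤ 2) =>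
      isAdmissiblePoint_ellipse h0 h1 hpos hlt (j := j) (by omega) (by omega) hv1 hv2
    have hθ : 0 ≤ 7 / 8 * meshPoint N ε lam 0 := by positivity
    -- Taking `U` as the whole preimage of the right half plane avoids describing a neighbourhood of
    -- the ellipse.
    refine norm_sub_chebInterp_le (f := fun z => K (s z))
      (U := {z | 0 < (s z).re}) ?_ ?_ ?_ ?_ ?_ p ⟨hxj'.le, hxj⟩
    · exact isOpen_lt continuous_const (Complex.continuous_re.comp hsd.continuous)
    · exact hK.comp hsd.differentiableOn fun z hz => hz
    · exact breakpoint_lt_succ h0 h1 hpos hlt1 (by omega)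
    · intro v hv1 hv2
      have := (hadm v hv1 hv2).re_pos h0
      rw [mem_ofPred_eq, hsre]
      positivity
    · intro v hv
      have hz := hadm v (by linarith) hv.le
      refine hB _ ?_ ?_ ?_
      · rw [hsre]
        exact div_pos (hz.re_pos h0) hτ
      · rw [hsnorm]
        gcongr
        exact hz.sin_le_norm h0 hθ
      · rw [hsnorm]
        gcongr
        exact hz.norm_le h0 h1

end MeshEllipses

/-! ### Evaluation points -/

section EvaluationPoints

variable {N : ℕ} {ε lam : ℝ}

theorem re_laplacePoint_pos (h0 : 0 < lam) (h1 : lam < 1) {τ : ℝ} (hτ : 0 < τ) (φ : ℝ) :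
    0 < (laplacePoint eulerDelta τ lam φ).re := by
  rw [laplacePoint, eulerDelta, Complex.div_ofReal_re, Complex.sub_re, re_lam_mul_exp]
  have := Real.cos_le_one φ
  simp only [Complex.one_re, Complex.ofReal_im, neg_zero, Real.exp_zero, mul_one,
    Complex.ofReal_re]
  refine div_pos ?_ hτ
  nlinarith

theorem re_pos_of_mem_evaluationPoints (h0 : 0 < lam) (h1 : lam < 1) {τ : ℝ} (hτ : 0 < τ)
    {L p : ℕ} {s : ℂ} (hs : s ∈ evaluationPoints eulerDelta N L τ ε lam p) : 0 < s.re := by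
  rw [evaluationPoints, List.mem_append, List.mem_map, List.mem_flatMap] at hs
  rcases hs with ⟨l, -, rfl⟩ | ⟨j, -, hs⟩
  · exact re_laplacePoint_pos h0 h1 hτ _
  · rw [List.mem_ofFn] at hs
    obtain ⟨i, rfl⟩ := hs
    exact re_laplacePoint_pos h0 h1 hτ _

theorem sampleAngle_le (L l : ℕ) : sampleAngle L l ≤ 2 * Real.pi := by
  rw [sampleAngle, sub_le_self_iff]
  positivity

theorem parsimoniousCQ_congr {X Y : Type*} [NormedAddCommGroup X] [NormedSpace ℂ X]
    [NormedAddCommGroup Y] [NormedSpace ℂ Y] (h0 : 0 < lam) (h1 : lam < 1)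
    (hpos : 0 < meshPoint N ε lam 0) (hlt : meshPoint N ε lam 0 < 1) {L p : ℕ} {τ : ℝ}
    {δ : ℂ → ℂ} {K K' : ℂ → X →L[ℂ] Y}
    (hK : ∀ s ∈ evaluationPoints δ N L τ ε lam p, K s = K' s) (g : ℕ → X) (n : ℕ) :
    parsimoniousCQ δ N L τ ε lam p K g n = parsimoniousCQ δ N L τ ε lam p K' g n := by
  unfold parsimoniousCQ
  congr 1
  refine Finset.sum_congr rfl fun l hl => ?_
  congr 2
  set x := sampleAngle L l with hx
  unfold meshInterp
  split_ifs with hout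
  · refine hK _ ?_
    rw [evaluationPoints, List.mem_append, List.mem_map]
    exact Or.inl ⟨l, by simpa [hx] using ⟨Finset.mem_range.mp hl, hout⟩, rfl⟩
  · rw [IsOuterElement, not_or] at hout
    obtain ⟨hj, -⟩ := le_breakpoint_elementIndex h0 h1 hpos hlt (sampleAngle_le L l)
    obtain ⟨k, hk⟩ := Nat.exists_eq_succ_of_ne_zero hout.1
    rw [hk] at hout ⊢
    rw [← hx, hk] at hj
    unfold chebInterp
    refine Finset.sum_congr rfl fun i _ => ?_
    refine congrArg _ (hK _ ?_)
    rw [evaluationPoints, List.mem_append, List.mem_flatMap]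
    -- Inner elements are numbered from `1` to `2M`, so element `k + 1` sits at list position `k`.
    refine Or.inr ⟨k, ?_, ?_⟩
    · rw [List.mem_range]; omega
    · rw [List.mem_ofFn]
      exact ⟨i, rfl⟩

/-- Sample angles have spacing `2π/N` and each outer element has length `Φ₀`, hence at most `⌈N
Φ₀/(2π)⌉` samples. Angles decrease in `l`: the first element receives the largest indices, the last
element the smallest. -/
theorem length_evaluationPoints_le (h0 : 0 < lam) (h1 : lam < 1)
    (hpos : 0 < meshPoint N ε lam 0) (hlt : meshPoint N ε lam 0 < 1) (hN : 0 < N)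
    (δ : ℂ → ℂ) (τ : ℝ) (p : ℕ) :
    ((evaluationPoints δ N N τ ε lam p).length : ℝ)
      ≤ N * meshPoint N ε lam 0 + 2 + 2 * meshIndex N ε lam * (p + 1) := by
  have hNpos : (0 : ℝ) < N := by exact_mod_cast hN
  have hpi3 := Real.pi_gt_three
  set k := ⌈N * meshPoint N ε lam 0 / (2 * Real.pi)⌉₊ with hk
  have hkge : N * meshPoint N ε lam 0 / (2 * Real.pi) ≤ k := Nat.le_ceil _
  have hklt : (k : ℝ) < N * meshPoint N ε lam 0 / (2 * Real.pi) + 1 :=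
    Nat.ceil_lt_add_one (by positivity)
  have hcard : ((List.range N).filter (fun l => decide (IsOuterElement N ε lam
      (elementIndex N ε lam (sampleAngle N l))))).length ≤ 2 * k := by
    have hsub : (Finset.range N).filter (fun l => IsOuterElement N ε lam
        (elementIndex N ε lam (sampleAngle N l))) ⊆ Finset.range k ∪ Finset.Ico (N - k) N := by
      intro l hl
      rw [Finset.mem_filter, Finset.mem_range] at hl
      obtain ⟨hlN, hout⟩ := hl
      rw [Finset.mem_union, Finset.mem_range, Finset.mem_Ico]
      obtain ⟨-, hle⟩ := le_breakpoint_elementIndex h0 h1 hpos hlt (sampleAngle_le N l)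
      rcases hout with h | h
      · right
        refine ⟨?_, hlN⟩
        rw [h, zero_add, breakpoint_of_le (by omega), halfBreakpoint, sampleAngle] at hle
        rw [Nat.sub_le_iff_le_add]
        have hkey : (N : ℝ) - l ≤ N * meshPoint N ε lam 0 / (2 * Real.pi) := by
          rw [le_div_iff₀ (by positivity)]
          have : 2 * Real.pi - 2 * Real.pi * l / N = (N - l) * (2 * Real.pi) / N := by
            field_simp
          rw [this, div_le_iff₀ hNpos] at hle
          linarith
        have : (N : ℝ) ≤ l + k := by linarith
        exact_mod_cast this
      · left
        have hgt := breakpoint_elementIndex_lt (N := N) (ε := ε) (lam := lam)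
          (x := sampleAngle N l) (by omega)
        rw [h, breakpoint_of_ge h0 h1 hpos hlt (by omega),
          show 2 * meshIndex N ε lam + 2 - (2 * meshIndex N ε lam + 1) = 0 + 1 by omega,
          halfBreakpoint, sampleAngle] at hgt
        have hkey : (l : ℝ) < N * meshPoint N ε lam 0 / (2 * Real.pi) := by
          rw [lt_div_iff₀ (by positivity)]
          have : 2 * Real.pi * l / N < meshPoint N ε lam 0 := by linarith
          rw [div_lt_iff₀ hNpos] at this
          linarith
        exact_mod_cast hkey.trans_le hkge
    calc _ = ((Finset.range N).filter (fun l => IsOuterElement N ε lam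
          (elementIndex N ε lam (sampleAngle N l)))).card := rfl
      _ ≤ (Finset.range k ∪ Finset.Ico (N - k) N).card := Finset.card_le_card hsub
      _ ≤ k + (N - (N - k)) := by
          refine (Finset.card_union_le _ _).trans ?_
          rw [Finset.card_range, Nat.card_Ico]
      _ ≤ 2 * k := by omega
  have hlen : (evaluationPoints δ N N τ ε lam p).length
      = ((List.range N).filter (fun l => decide (IsOuterElement N ε lam
        (elementIndex N ε lam (sampleAngle N l))))).length
        + 2 * meshIndex N ε lam * (p + 1) := by
    simp [evaluationPoints, List.length_flatMap]
  rw [hlen]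
  push_cast
  have hk2 : (2 * k : ℝ) ≤ N * meshPoint N ε lam 0 + 2 := by
    have : N * meshPoint N ε lam 0 / (2 * Real.pi) ≤ N * meshPoint N ε lam 0 / 2 := by
      gcongr
      linarith
    linarith
  have : (((List.range N).filter (fun l => decide (IsOuterElement N ε lam
      (elementIndex N ε lam (sampleAngle N l))))).length : ℝ) ≤ 2 * k := by exact_mod_cast hcard
  linarith

end EvaluationPoints

/-! ### The discrete Fourier transform -/

theorem rootOfUnity_isPrimitiveRoot {L : ℕ} (hL : L ≠ 0) : IsPrimitiveRoot (rootOfUnity L) L := by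
  exact Complex.isPrimitiveRoot_exp L hL

theorem rootOfUnity_ne_zero (L : ℕ) : rootOfUnity L ≠ 0 := Complex.exp_ne_zero _

theorem norm_rootOfUnity (L : ℕ) : ‖rootOfUnity L‖ = 1 := by
  rw [rootOfUnity, Complex.norm_exp]
  simp [Complex.div_natCast_re]

theorem conj_rootOfUnity_pow (L n : ℕ) :
    (starRingEnd ℂ) (rootOfUnity L ^ n) = (rootOfUnity L ^ n)⁻¹ := by
  rw [Complex.inv_def, Complex.normSq_eq_norm_sq, norm_pow, norm_rootOfUnity]
  simp

theorem sum_rootOfUnity_pow_mul_inv {L : ℕ} (hL : L ≠ 0) (n m : ℕ) :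
    ∑ l ∈ Finset.range L, rootOfUnity L ^ (l * n) * (rootOfUnity L ^ (l * m))⁻¹
      = if m % L = n % L then (L : ℂ) else 0 := by
  have hprim := rootOfUnity_isPrimitiveRoot hL
  have h0 := rootOfUnity_ne_zero L
  set w : ℂ := rootOfUnity L ^ n * (rootOfUnity L ^ m)⁻¹ with hw
  have hterm : ∀ l, rootOfUnity L ^ (l * n) * (rootOfUnity L ^ (l * m))⁻¹ = w ^ l := by
    intro l
    rw [hw, mul_pow, inv_pow, ← pow_mul, ← pow_mul, mul_comm n, mul_comm m]
  simp_rw [hterm]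
  have hone : w = 1 ↔ m % L = n % L := by
    have hz : w = rootOfUnity L ^ ((n : ℤ) - m) := by
      rw [hw, zpow_sub₀ h0, zpow_natCast, zpow_natCast, div_eq_mul_inv]
    rw [hz, hprim.zpow_eq_one_iff_dvd, ← Nat.modEq_iff_dvd]
    rfl
  split_ifs with h
  · rw [hone.mpr h]
    simp
  · have hw1 : w ≠ 1 := fun h' => h (hone.mp h')
    rw [geom_sum_eq hw1]
    have : w ^ L = 1 := by
      rw [hw, mul_pow, inv_pow, ← pow_mul, ← pow_mul, mul_comm n, mul_comm m, pow_mul, pow_mul,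
        hprim.pow_eq_one]
      simp
    rw [this, sub_self, zero_div]

section Hilbert

variable {E : Type*} [NormedAddCommGroup E] [InnerProductSpace ℂ E]

/-- A matrix with orthogonal columns of squared length `A` is `√A` times an isometry, also for
entries in a Hilbert space: expand the inner products. -/
theorem sum_norm_sq_of_orthogonal {ι κ : Type*} [DecidableEq κ] (s : Finset ι) (t : Finset κ)
    (c : ι → κ → ℂ) (A : ℝ)
    (h : ∀ i ∈ t, ∀ j ∈ t, ∑ l ∈ s, (starRingEnd ℂ) (c l i) * c l j = if i = j then (A : ℂ) else 0)
    (x : κ → E) :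
    ∑ l ∈ s, ‖∑ j ∈ t, c l j • x j‖ ^ 2 = A * ∑ j ∈ t, ‖x j‖ ^ 2 := by
  have hC : (∑ l ∈ s, ((‖∑ j ∈ t, c l j • x j‖ : ℂ)) ^ 2) = A * ∑ j ∈ t, (‖x j‖ : ℂ) ^ 2 := by
    have hsq : ∀ y : E, ((‖y‖ : ℂ)) ^ 2 = inner ℂ y y := fun y =>
      (inner_self_eq_norm_sq_to_K y).symm
    simp_rw [hsq, sum_inner, inner_sum, inner_smul_left, inner_smul_right]
    rw [Finset.sum_comm, Finset.mul_sum]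
    refine Finset.sum_congr rfl fun i hi => ?_
    rw [Finset.sum_comm]
    have : ∀ j ∈ t, ∑ l ∈ s, (starRingEnd ℂ) (c l i) * (c l j * inner ℂ (x i) (x j))
        = if i = j then A * inner ℂ (x i) (x j) else 0 := by
      intro j hj
      simp_rw [← mul_assoc]
      rw [← Finset.sum_mul, h i hi j hj]
      split_ifs <;> simp
    rw [Finset.sum_congr rfl this, Finset.sum_ite_eq t i, if_pos hi]
  exact_mod_cast hC

/-- Parseval's identity for the inverse discrete Fourier transform. -/
theorem sum_norm_sq_inverse_dft {L : ℕ} (hL : L ≠ 0) (v : ℕ → E) :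
    ∑ n ∈ Finset.range L, ‖∑ l ∈ Finset.range L, rootOfUnity L ^ (l * n) • v l‖ ^ 2
      = L * ∑ l ∈ Finset.range L, ‖v l‖ ^ 2 := by
  refine sum_norm_sq_of_orthogonal _ _ (fun n l => rootOfUnity L ^ (l * n)) L
    (fun i hi j hj => ?_) v
  rw [Finset.mem_range] at hi hj
  have := sum_rootOfUnity_pow_mul_inv hL j i
  rw [Nat.mod_eq_of_lt hi, Nat.mod_eq_of_lt hj] at this
  rw [← Complex.ofReal_natCast] at this
  rw [← this]
  refine Finset.sum_congr rfl fun n _ => ?_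
  rw [conj_rootOfUnity_pow, mul_comm, mul_comm j, mul_comm i]

/-- Parseval's identity for the discrete Fourier transform. -/
theorem sum_norm_sq_dft {L : ℕ} (hL : L ≠ 0) (t : Finset ℕ)
    (ht : ∀ i ∈ t, ∀ j ∈ t, i % L = j % L → i = j) (x : ℕ → E) :
    ∑ l ∈ Finset.range L, ‖∑ j ∈ t, (rootOfUnity L ^ (j * l))⁻¹ • x j‖ ^ 2
      = L * ∑ j ∈ t, ‖x j‖ ^ 2 := by
  refine sum_norm_sq_of_orthogonal _ _ (fun l j => (rootOfUnity L ^ (j * l))⁻¹) L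
    (fun i hi j hj => ?_) x
  have := sum_rootOfUnity_pow_mul_inv hL i j
  rw [← Complex.ofReal_natCast] at this
  have hiff : (j % L = i % L) ↔ i = j :=
    ⟨fun h => (ht j hj i hi h).symm, fun h => by rw [h]⟩
  simp only [hiff] at this
  rw [← this]
  refine Finset.sum_congr rfl fun n _ => ?_
  rw [map_inv₀, conj_rootOfUnity_pow, inv_inv, mul_comm j, mul_comm i]

/-- Stability of discrete Fourier multipliers. -/
theorem sum_norm_sq_multiplier_le {F : Type*} [NormedAddCommGroup F] [InnerProductSpace ℂ F]
    {L : ℕ} (hL : L ≠ 0) (t : Finset ℕ) (ht : ∀ i ∈ t, ∀ j ∈ t, i % L = j % L → i = j)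
    (x : ℕ → E) (v : ℕ → F) {κ : ℝ}
    (hv : ∀ l < L, ‖v l‖ ≤ κ * ‖∑ j ∈ t, (rootOfUnity L ^ (j * l))⁻¹ • x j‖) :
    ∑ n ∈ Finset.range L, ‖(L : ℂ)⁻¹ • ∑ l ∈ Finset.range L, rootOfUnity L ^ (l * n) • v l‖ ^ 2
      ≤ κ ^ 2 * ∑ j ∈ t, ‖x j‖ ^ 2 := by
  have hLpos : (0 : ℝ) < L := by exact_mod_cast Nat.pos_of_ne_zero hL
  simp_rw [norm_smul, mul_pow]
  rw [← Finset.mul_sum, sum_norm_sq_inverse_dft hL, norm_inv, Complex.norm_natCast]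
  have h1 : ∑ l ∈ Finset.range L, ‖v l‖ ^ 2 ≤ κ ^ 2 * (L * ∑ j ∈ t, ‖x j‖ ^ 2) := by
    rw [← sum_norm_sq_dft hL t ht, Finset.mul_sum]
    refine Finset.sum_le_sum fun l hl => ?_
    rw [← mul_pow]
    exact pow_le_pow_left₀ (norm_nonneg _) (hv l (Finset.mem_range.mp hl)) 2
  calc ((L : ℝ)⁻¹) ^ 2 * (L * ∑ l ∈ Finset.range L, ‖v l‖ ^ 2)
      ≤ ((L : ℝ)⁻¹) ^ 2 * (L * (κ ^ 2 * (L * ∑ j ∈ t, ‖x j‖ ^ 2))) := by gcongr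
    _ = κ ^ 2 * ∑ j ∈ t, ‖x j‖ ^ 2 := by field_simp

end Hilbert

/-! ### Aliasing -/

section Aliasing

open Filter Topology

variable {E : Type*} [NormedAddCommGroup E] [NormedSpace ℂ E]

/-- Convergence at an intermediate radius `R` bounds the terms there; a geometric series of ratio
`r/R` then dominates. -/
theorem summable_pow_mul_norm {y : ℕ → E} {H : ℂ → E}
    (hy : ∀ z : ℂ, ‖z‖ < 1 → HasSum (fun m => z ^ m • y m) (H z)) {r : ℝ} (hr0 : 0 ≤ r)
    (hr1 : r < 1) : Summable fun m => r ^ m * ‖y m‖ := by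
  obtain ⟨R, hrR, hR1⟩ := exists_between hr1
  have hR0 : 0 < R := hr0.trans_lt hrR
  have hsum := hy (R : ℂ) (by rwa [Complex.norm_real, Real.norm_of_nonneg hR0.le])
  obtain ⟨C, hC⟩ := hsum.summable.tendsto_atTop_zero.norm.bddAbove_range
  have hbound : ∀ m, R ^ m * ‖y m‖ ≤ C := by
    intro m
    have := hC (mem_range_self m)
    simpa [norm_smul, abs_of_pos hR0] using this
  have hgeo : Summable fun m => C * (r / R) ^ m :=
    (summable_geometric_of_lt_one (by positivity) ((div_lt_one hR0).mpr hrR)).mul_left C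
  refine Summable.of_nonneg_of_le (fun m => by positivity) (fun m => ?_) hgeo
  have hRm : 0 < R ^ m := by positivity
  calc r ^ m * ‖y m‖ = (R ^ m * ‖y m‖) * (r / R) ^ m := by rw [div_pow]; field_simp
    _ ≤ C * (r / R) ^ m := by
        gcongr
        exact hbound m

/-- The trapezoidal rule for Taylor coefficients picks up all coefficients of the residue class. -/
theorem hasSum_aliasing {y : ℕ → E} {H : ℂ → E}
    (hy : ∀ z : ℂ, ‖z‖ < 1 → HasSum (fun m => z ^ m • y m) (H z)) {r : ℝ} (hr0 : 0 ≤ r)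
    (hr1 : r < 1) {L : ℕ} (hL : L ≠ 0) (n : ℕ) :
    HasSum (fun m => if m % L = n % L then ((r : ℂ) ^ m) • y m else 0)
      ((L : ℂ)⁻¹ • ∑ l ∈ Finset.range L,
        rootOfUnity L ^ (l * n) • H ((r : ℂ) * (rootOfUnity L ^ l)⁻¹)) := by
  have hLC : (L : ℂ) ≠ 0 := by exact_mod_cast hL
  have h := (hasSum_sum (s := Finset.range L) fun l _ =>
    (hy ((r : ℂ) * (rootOfUnity L ^ l)⁻¹) (by
      rw [norm_mul, norm_inv, norm_pow, norm_rootOfUnity, Complex.norm_real,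
        Real.norm_of_nonneg hr0]
      simpa using hr1)).const_smul (rootOfUnity L ^ (l * n))).const_smul ((L : ℂ)⁻¹)
  convert h using 2 with m
  have hterm : ∑ l ∈ Finset.range L, rootOfUnity L ^ (l * n) •
      ((r : ℂ) * (rootOfUnity L ^ l)⁻¹) ^ m • y m
      = (if m % L = n % L then (L : ℂ) else 0) • ((r : ℂ) ^ m) • y m := by
    rw [← sum_rootOfUnity_pow_mul_inv hL n m, Finset.sum_smul]
    refine Finset.sum_congr rfl fun l _ => ?_
    rw [smul_smul, smul_smul, mul_pow, inv_pow, ← pow_mul]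
    congr 1
    ring
  rw [hterm]
  split_ifs
  · rw [smul_smul, inv_mul_cancel₀ hLC, one_smul]
  · simp

/-- As `L → ∞`, each fixed `m ≠ n` eventually leaves the residue class of `n` modulo `L`; dominated
convergence removes all aliased terms. -/
theorem tendsto_trapezoidal [CompleteSpace E] {y : ℕ → E} {H : ℂ → E}
    (hy : ∀ z : ℂ, ‖z‖ < 1 → HasSum (fun m => z ^ m • y m) (H z)) {r : ℝ} (hr0 : 0 ≤ r)
    (hr1 : r < 1) (n : ℕ) :
    Tendsto (fun L : ℕ => (L : ℂ)⁻¹ • ∑ l ∈ Finset.range L,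
        rootOfUnity L ^ (l * n) • H ((r : ℂ) * (rootOfUnity L ^ l)⁻¹)) atTop
      (𝓝 (((r : ℂ) ^ n) • y n)) := by
  have hlim : Tendsto (fun L : ℕ => ∑' m, if m % L = n % L then ((r : ℂ) ^ m) • y m else 0) atTop
      (𝓝 (∑' m, if m = n then ((r : ℂ) ^ m) • y m else 0)) := by
    refine tendsto_tsum_of_dominated_convergence (summable_pow_mul_norm hy hr0 hr1)
      (fun m => ?_) (Eventually.of_forall fun L m => ?_)
    · refine tendsto_const_nhds.congr' ?_
      filter_upwards [eventually_gt_atTop (max m n)] with L hL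
      rw [Nat.mod_eq_of_lt ((le_max_left _ _).trans_lt hL),
        Nat.mod_eq_of_lt ((le_max_right _ _).trans_lt hL)]
    · split_ifs
      · simp [norm_smul, abs_of_nonneg hr0]
      · rw [norm_zero]; positivity
  rw [tsum_ite_eq] at hlim
  refine hlim.congr' ?_
  filter_upwards [eventually_ne_atTop 0] with L hL
  exact (hasSum_aliasing hy hr0 hr1 hL n).tsum_eq

end Aliasing

section Parseval

open Filter Topology

variable {X Y : Type*} [NormedAddCommGroup X] [InnerProductSpace ℂ X]
  [NormedAddCommGroup Y] [InnerProductSpace ℂ Y] [CompleteSpace Y]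

/-- Plancherel bound for the Taylor coefficients of the product of an operator-valued function,
bounded by `κ` on a circle, and a polynomial. -/
theorem sum_pow_mul_norm_sq_le {y : ℕ → Y} {H : ℂ → Y}
    (hy : ∀ z : ℂ, ‖z‖ < 1 → HasSum (fun m => z ^ m • y m) (H z)) {r : ℝ} (hr0 : 0 ≤ r)
    (hr1 : r < 1) {N : ℕ} {x : ℕ → X} {κ : ℝ}
    (hH : ∀ z : ℂ, ‖z‖ = r → ‖H z‖ ≤ κ * ‖∑ j ∈ Finset.range (N + 1), z ^ j • x j‖) (Q : ℕ) :
    ∑ n ∈ Finset.range Q, (r ^ n * ‖y n‖) ^ 2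
      ≤ κ ^ 2 * ∑ j ∈ Finset.range (N + 1), ‖x j‖ ^ 2 := by
  -- Plancherel is obtained as the limit of discrete Parseval with `L → ∞` nodes.
  have hlim : Tendsto (fun L : ℕ => ∑ n ∈ Finset.range Q, ‖(L : ℂ)⁻¹ • ∑ l ∈ Finset.range L,
        rootOfUnity L ^ (l * n) • H ((r : ℂ) * (rootOfUnity L ^ l)⁻¹)‖ ^ 2) atTop
      (𝓝 (∑ n ∈ Finset.range Q, ‖((r : ℂ) ^ n) • y n‖ ^ 2)) :=
    tendsto_finsetSum _ fun n _ => (tendsto_trapezoidal hy hr0 hr1 n).norm.pow 2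
  have heq : ∀ n, ‖((r : ℂ) ^ n) • y n‖ = r ^ n * ‖y n‖ := by
    intro n
    simp [norm_smul, abs_of_nonneg hr0]
  simp_rw [heq] at hlim
  refine le_of_tendsto hlim ?_
  filter_upwards [eventually_gt_atTop (max Q N)] with L hL
  have hQL : Q ≤ L := ((le_max_left _ _).trans_lt hL).le
  have hNL : N + 1 ≤ L := (le_max_right _ _).trans_lt hL
  have hL0 : L ≠ 0 := by omega
  have hmul := sum_norm_sq_multiplier_le hL0 (Finset.range (N + 1))
    (fun i hi j hj hij => by
      rw [Finset.mem_range] at hi hj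
      rwa [Nat.mod_eq_of_lt (by omega), Nat.mod_eq_of_lt (by omega)] at hij)
    (fun j => ((r : ℂ) ^ j) • x j) (fun l => H ((r : ℂ) * (rootOfUnity L ^ l)⁻¹)) (κ := κ)
    (fun l _ => by
      refine (hH _ ?_).trans (le_of_eq ?_)
      · rw [norm_mul, norm_inv, norm_pow, norm_rootOfUnity, Complex.norm_real,
          Real.norm_of_nonneg hr0]
        simp
      · congr 2
        refine Finset.sum_congr rfl fun j _ => ?_
        rw [smul_smul, mul_pow, inv_pow, ← pow_mul, mul_comm l j, mul_comm])
  refine (Finset.sum_le_sum_of_subset_of_nonneg (Finset.range_mono hQL)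
    fun _ _ _ => by positivity).trans (hmul.trans ?_)
  gcongr with j hj
  rw [norm_smul, norm_pow, Complex.norm_real, Real.norm_of_nonneg hr0]
  exact mul_le_of_le_one_left (norm_nonneg _) (pow_le_one₀ hr0 hr1.le)

/-- The aliasing error of the scaled trapezoidal rule with `N` points, for sequences of length
`N + 1` that start with `0`. -/
theorem sum_norm_sq_aliasing_le {y : ℕ → Y} {H : ℂ → Y}
    (hy : ∀ z : ℂ, ‖z‖ < 1 → HasSum (fun m => z ^ m • y m) (H z)) (hy0 : y 0 = 0) {r lam : ℝ}
    (hlam0 : 0 < lam) (hlam1 : lam < 1) (hr0 : 0 < r) (hr1 : r < 1) {N : ℕ} (hN : N ≠ 0)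
    {x : ℕ → X} {κ : ℝ}
    (hH : ∀ z : ℂ, ‖z‖ = r → ‖H z‖ ≤ κ * ‖∑ j ∈ Finset.range (N + 1), z ^ j • x j‖)
    {q : ℝ} (hq : (lam / r) ^ (2 * N) = q) (hq1 : q < 1) :
    ∑ n ∈ Finset.range (N + 1), ‖((lam : ℂ) ^ n)⁻¹ • ((N : ℂ)⁻¹ • ∑ l ∈ Finset.range N,
        rootOfUnity N ^ (l * n) • H ((lam : ℂ) * (rootOfUnity N ^ l)⁻¹)) - y n‖ ^ 2
      ≤ (r ^ (2 * N))⁻¹ * (q / (1 - q))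
        * (2 * (κ ^ 2 * ∑ j ∈ Finset.range (N + 1), ‖x j‖ ^ 2)) := by
  set A := κ ^ 2 * ∑ j ∈ Finset.range (N + 1), ‖x j‖ ^ 2 with hA
  have hq0 : 0 < q := by rw [← hq]; positivity
  have hlamC : (lam : ℂ) ≠ 0 := by exact_mod_cast hlam0.ne'
  -- the error is a sum over the residue class
  have herr : ∀ n ∈ Finset.range (N + 1),
      HasSum (fun i : ℕ => ((lam : ℂ) ^ ((i + 1) * N)) • y (n + (i + 1) * N))
        (((lam : ℂ) ^ n)⁻¹ • ((N : ℂ)⁻¹ • ∑ l ∈ Finset.range N,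
          rootOfUnity N ^ (l * n) • H ((lam : ℂ) * (rootOfUnity N ^ l)⁻¹)) - y n) := by
    intro n hn
    rw [Finset.mem_range] at hn
    have hal := hasSum_aliasing hy hlam0.le hlam1 hN n
    have h1 := hal.sub (hasSum_ite_eq n (((lam : ℂ) ^ n) • y n))
    have hinj : Function.Injective fun i : ℕ => n + (i + 1) * N := by
      intro a b hab
      have : (a + 1) * N = (b + 1) * N := Nat.add_left_cancel hab
      have := Nat.eq_of_mul_eq_mul_right (Nat.pos_of_ne_zero hN) this
      omega
    rw [← hinj.hasSum_iff] at h1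
    · have h2 := h1.const_smul (((lam : ℂ) ^ n)⁻¹)
      convert h2 using 1
      · funext i
        have hne : n + (i + 1) * N ≠ n := by
          have : 0 < (i + 1) * N := by positivity
          omega
        simp only [Function.comp_apply, Nat.add_mul_mod_self_right, if_true, if_neg hne, sub_zero]
        rw [smul_smul, pow_add, inv_mul_cancel_left₀ (pow_ne_zero _ hlamC)]
      · rw [smul_sub _ (_ : Y) (((lam : ℂ) ^ n) • y n), smul_smul _ ((lam : ℂ) ^ n),
          inv_mul_cancel₀ (pow_ne_zero _ hlamC), one_smul]
    · intro m hm
      by_cases hmn : m = n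
      · rw [if_pos (by rw [hmn]), if_pos hmn, hmn, sub_self]
      rw [if_neg hmn, sub_zero]
      split_ifs with hmod
      -- A smaller index in the residue class of `n ≤ N` can only be `0` (with `n = N`), and there
      -- `y 0 = 0`.
      · rcases lt_or_gt_of_ne hmn with hlt | hgt
        · have hmz : m = 0 := by
            have hdvd : N ∣ n - m := (Nat.modEq_iff_dvd' hlt.le).mp hmod
            have := Nat.le_of_dvd (by omega) hdvd
            omega
          rw [hmz, hy0, smul_zero]
        · exfalso
          apply hm
          obtain ⟨d, hd⟩ : N ∣ m - n := (Nat.modEq_iff_dvd' hgt.le).mp (Eq.symm hmod)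
          have hd0 : d ≠ 0 := by rintro rfl; omega
          obtain ⟨i, rfl⟩ := Nat.exists_eq_succ_of_ne_zero hd0
          refine ⟨i, ?_⟩
          simp only
          rw [mul_comm (i + 1) N]
          have : N * i.succ = N * (i + 1) := rfl
          omega
      · rfl
  -- bound of the coefficients
  set f : ℕ → ℝ := fun m => (r ^ m * ‖y m‖) ^ 2 with hf
  have hfsum : Summable f := summable_of_sum_range_le (fun _ => sq_nonneg _)
    (sum_pow_mul_norm_sq_le hy hr0.le hr1 hH)
  have hftsum : ∑' m, f m ≤ A := hfsum.tsum_le_of_sum_range_le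
    (sum_pow_mul_norm_sq_le hy hr0.le hr1 hH)
  have hgeo : ∀ Q : ℕ, ∑ i ∈ Finset.range Q, q ^ (i + 1) ≤ q / (1 - q) := by
    intro Q
    have := Summable.sum_le_tsum (Finset.range Q) (fun i _ => by positivity)
      ((summable_geometric_of_lt_one hq0.le hq1).mul_left q)
    rw [tsum_mul_left, tsum_geometric_of_lt_one hq0.le hq1] at this
    simpa [pow_succ', div_eq_mul_inv] using this
  have hD0 : 0 ≤ (r ^ (2 * N))⁻¹ * (q / (1 - q)) := by
    have : 0 < 1 - q := by linarith
    positivity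
  have hpartial : ∀ Q : ℕ, ∀ n ∈ Finset.range (N + 1),
      ‖∑ i ∈ Finset.range Q, ((lam : ℂ) ^ ((i + 1) * N)) • y (n + (i + 1) * N)‖ ^ 2
        ≤ (r ^ (2 * N))⁻¹ * (q / (1 - q)) * ∑ i ∈ Finset.range Q, f (n + (i + 1) * N) := by
    intro Q n hn
    have hnN : n ≤ N := Nat.lt_succ_iff.mp (Finset.mem_range.mp hn)
    have h1 : ‖∑ i ∈ Finset.range Q, ((lam : ℂ) ^ ((i + 1) * N)) • y (n + (i + 1) * N)‖
        ≤ ∑ i ∈ Finset.range Q, ((r ^ n)⁻¹ * (lam / r) ^ ((i + 1) * N))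
          * (r ^ (n + (i + 1) * N) * ‖y (n + (i + 1) * N)‖) := by
      refine (norm_sum_le _ _).trans (le_of_eq (Finset.sum_congr rfl fun i _ => ?_))
      rw [norm_smul, norm_pow, Complex.norm_real, Real.norm_of_nonneg hlam0.le, div_pow, pow_add]
      field_simp
    -- Cauchy–Schwarz separates the geometric damping from the Plancherel weights.
    have h2 := Finset.sum_mul_sq_le_sq_mul_sq (Finset.range Q)
      (fun i => (r ^ n)⁻¹ * (lam / r) ^ ((i + 1) * N))
      (fun i => r ^ (n + (i + 1) * N) * ‖y (n + (i + 1) * N)‖)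
    have h3 : ∑ i ∈ Finset.range Q, ((r ^ n)⁻¹ * (lam / r) ^ ((i + 1) * N)) ^ 2
        ≤ (r ^ (2 * N))⁻¹ * (q / (1 - q)) := by
      have : ∀ i, ((r ^ n)⁻¹ * (lam / r) ^ ((i + 1) * N)) ^ 2
          = (r ^ (2 * n))⁻¹ * q ^ (i + 1) := by
        intro i
        rw [mul_pow, ← hq, ← pow_mul, ← pow_mul, inv_pow, ← pow_mul]
        congr 2
        · rw [mul_comm]
        · ring
      simp_rw [this]
      rw [← Finset.mul_sum]
      have hle : (r ^ (2 * n))⁻¹ ≤ (r ^ (2 * N))⁻¹ :=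
        inv_anti₀ (by positivity) (pow_le_pow_of_le_one hr0.le hr1.le (by omega))
      exact mul_le_mul hle (hgeo Q) (Finset.sum_nonneg fun i _ => by positivity) (by positivity)
    refine (pow_le_pow_left₀ (norm_nonneg _) h1 2).trans (h2.trans ?_)
    exact mul_le_mul_of_nonneg_right h3 (Finset.sum_nonneg fun i _ => sq_nonneg _)
  have htotal : ∀ Q : ℕ, ∑ n ∈ Finset.range (N + 1), ∑ i ∈ Finset.range Q,
      f (n + (i + 1) * N) ≤ 2 * A := by
    intro Q
    -- For `n < N` the indices `n + (i+1)N` are pairwise distinct; the row `n = N` repeats some of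
    -- them, which costs the factor `2`.
    rw [Finset.sum_range_succ, two_mul]
    refine add_le_add ?_ ?_
    · rw [← Finset.sum_product']
      have hinj : InjOn (fun a : ℕ × ℕ => a.1 + (a.2 + 1) * N)
          (Finset.range N ×ˢ Finset.range Q : Finset (ℕ × ℕ)) := by
        rintro ⟨a, i⟩ ha ⟨b, j⟩ hb hab
        simp only [Finset.coe_product, mem_prod, Finset.mem_coe, Finset.mem_range] at ha hb hab
        have hmod := congrArg (· % N) hab
        simp only [Nat.add_mul_mod_self_right, Nat.mod_eq_of_lt ha.1, Nat.mod_eq_of_lt hb.1]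
          at hmod
        subst hmod
        have := Nat.eq_of_mul_eq_mul_right (Nat.pos_of_ne_zero hN) (Nat.add_left_cancel hab)
        simp only [Prod.mk.injEq, true_and]
        omega
      rw [← Finset.sum_image (f := f) hinj]
      exact (hfsum.sum_le_tsum _ fun _ _ => sq_nonneg _).trans hftsum
    · have hinj : InjOn (fun i : ℕ => N + (i + 1) * N) (Finset.range Q : Finset ℕ) := by
        intro a _ b _ hab
        have := Nat.eq_of_mul_eq_mul_right (Nat.pos_of_ne_zero hN) (Nat.add_left_cancel hab)
        omega
      rw [← Finset.sum_image (f := f) hinj]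
      exact (hfsum.sum_le_tsum _ fun _ _ => sq_nonneg _).trans hftsum
  have hlim := tendsto_finsetSum (Finset.range (N + 1)) fun n hn =>
    ((herr n hn).tendsto_sum_nat.norm.pow 2)
  refine le_of_tendsto' hlim fun Q => ?_
  calc _ ≤ ∑ n ∈ Finset.range (N + 1), (r ^ (2 * N))⁻¹ * (q / (1 - q))
          * ∑ i ∈ Finset.range Q, f (n + (i + 1) * N) :=
        Finset.sum_le_sum fun n hn => hpartial Q n hn
    _ ≤ (r ^ (2 * N))⁻¹ * (q / (1 - q)) * (2 * A) := by
        rw [← Finset.mul_sum]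
        exact mul_le_mul_of_nonneg_left (htotal Q) hD0

end Parseval

/-! ### Convolution quadrature -/

section CQ

variable {X Y : Type*} [NormedAddCommGroup X] [InnerProductSpace ℂ X]
  [NormedAddCommGroup Y] [InnerProductSpace ℂ Y]

theorem re_eulerDelta_div_pos {τ : ℝ} (hτ : 0 < τ) {z : ℂ} (hz : ‖z‖ < 1) :
    0 < (eulerDelta z / (τ : ℂ)).re := by
  rw [eulerDelta, Complex.div_ofReal_re, Complex.sub_re, Complex.one_re]
  refine div_pos ?_ hτ
  linarith [Complex.re_le_norm z]

theorem hasSum_cqWeight [CompleteSpace Y] {K : ℂ → X →L[ℂ] Y} (hK : DifferentiableOn ℂ K {s : ℂ | 0 < s.re})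
    {τ : ℝ} (hτ : 0 < τ) {z : ℂ} (hz : ‖z‖ < 1) :
    HasSum (fun m => z ^ m • cqWeight eulerDelta τ K m) (K (eulerDelta z / (τ : ℂ))) := by
  have hd : DifferentiableOn ℂ (fun ζ : ℂ => K (eulerDelta ζ / (τ : ℂ))) (Metric.ball 0 1) := by
    refine hK.comp (s := Metric.ball 0 1) (f := fun ζ : ℂ => eulerDelta ζ / (τ : ℂ)) ?_ ?_
    · unfold eulerDelta
      fun_prop
    · intro ζ hζ
      exact re_eulerDelta_div_pos hτ (by simpa using hζ)
  have hsum := Complex.hasSum_taylorSeries_on_ball hd (z := z) (by simpa using hz)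
  have hfun : (fun m => z ^ m • cqWeight eulerDelta τ K m) = fun m => ((m.factorial : ℂ))⁻¹ •
      (z - 0) ^ m • iteratedDeriv m (fun ζ : ℂ => K (eulerDelta ζ / (τ : ℂ))) 0 := by
    funext m
    rw [cqWeight, sub_zero, smul_comm]
  rw [hfun]
  exact hsum

/-- The sequence of all CQ approximations for data that vanish after the index `N`. -/
noncomputable def cqFull (τ : ℝ) (K : ℂ → X →L[ℂ] Y) (N : ℕ) (x : ℕ → X) (m : ℕ) : Y :=
  ∑ j ∈ Finset.range (N + 1), if j ≤ m then cqWeight eulerDelta τ K (m - j) (x j) else 0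

theorem cqFull_eq_cq {τ : ℝ} {K : ℂ → X →L[ℂ] Y} {N : ℕ} {x : ℕ → X} {n : ℕ} (hn : n ≤ N) :
    cqFull τ K N x n = cq eulerDelta τ K x n := by
  rw [cqFull, cq, ← Finset.sum_filter]
  refine Finset.sum_congr ?_ fun _ _ => rfl
  ext j
  simp only [Finset.mem_filter, Finset.mem_range]
  omega

theorem cqFull_zero {τ : ℝ} {K : ℂ → X →L[ℂ] Y} {N : ℕ} {x : ℕ → X} (hx : x 0 = 0) :
    cqFull τ K N x 0 = 0 := by
  rw [cqFull_eq_cq (Nat.zero_le N), cq]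
  simp [hx]

/-- The generating function of the CQ approximations. -/
noncomputable def cqGenerating (τ : ℝ) (K : ℂ → X →L[ℂ] Y) (N : ℕ) (x : ℕ → X) (z : ℂ) : Y :=
  K (eulerDelta z / (τ : ℂ)) (∑ j ∈ Finset.range (N + 1), z ^ j • x j)

/-- A Cauchy product of the weight series with a polynomial: each datum `x j` shifts the series by
`j`, and the shifts are summed. The values beyond `N` are those which aliasing picks up. -/
theorem hasSum_cqFull [CompleteSpace Y] {K : ℂ → X →L[ℂ] Y}
    (hK : DifferentiableOn ℂ K {s : ℂ | 0 < s.re})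
    {τ : ℝ} (hτ : 0 < τ) (N : ℕ) (x : ℕ → X) {z : ℂ} (hz : ‖z‖ < 1) :
    HasSum (fun m => z ^ m • cqFull τ K N x m) (cqGenerating τ K N x z) := by
  have hj : ∀ j : ℕ, HasSum
      (fun m => if j ≤ m then z ^ m • cqWeight eulerDelta τ K (m - j) (x j) else 0)
      (K (eulerDelta z / (τ : ℂ)) (z ^ j • x j)) := by
    intro j
    have h1 := (ContinuousLinearMap.apply ℂ Y (z ^ j • x j)).hasSum (hasSum_cqWeight hK hτ hz)
    have hinj : Function.Injective fun m : ℕ => m + j := add_left_injective j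
    rw [← hinj.hasSum_iff]
    · convert h1 using 1
      · funext m
        simp only [Function.comp_apply, Nat.le_add_left, if_true, Nat.add_sub_cancel,
          ContinuousLinearMap.apply_apply, smul_apply, map_smul, smul_smul, pow_add]
      · rfl
    · intro m hm
      rw [if_neg]
      intro hjm
      exact hm ⟨m - j, Nat.sub_add_cancel hjm⟩
  have := hasSum_sum (s := Finset.range (N + 1)) fun j _ => hj j
  rw [← map_sum] at this
  convert this using 1
  · funext m
    rw [cqFull, Finset.smul_sum]
    refine Finset.sum_congr rfl fun j _ => ?_
    split_ifs <;> simp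
  · rfl

theorem laplacePoint_sampleAngle {N : ℕ} (τ lam : ℝ) (l : ℕ) :
    laplacePoint eulerDelta τ lam (sampleAngle N l)
      = eulerDelta ((lam : ℂ) * (rootOfUnity N ^ l)⁻¹) / (τ : ℂ) := by
  rw [laplacePoint, sampleAngle, rootOfUnity, ← Complex.exp_nat_mul, ← Complex.exp_neg]
  congr 3
  rw [← Complex.exp_periodic.sub_eq (Complex.I * _)]
  congr 1
  push_cast
  ring

/-- The difference between parsimonious CQ and the scaled trapezoidal rule. -/
theorem parsimoniousCQ_sub_eq {N : ℕ} (τ ε lam : ℝ) (p : ℕ)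
    (K : ℂ → X →L[ℂ] Y) (x : ℕ → X) (n : ℕ) :
    ((lam : ℂ) ^ n)⁻¹ • ((N : ℂ)⁻¹ • ∑ l ∈ Finset.range N,
        rootOfUnity N ^ (l * n) • cqGenerating τ K N x ((lam : ℂ) * (rootOfUnity N ^ l)⁻¹))
      - parsimoniousCQ eulerDelta N N τ ε lam p K x n
    = ((lam : ℂ) ^ n)⁻¹ • ((N : ℂ)⁻¹ • ∑ l ∈ Finset.range N, rootOfUnity N ^ (l * n) •
        (K (laplacePoint eulerDelta τ lam (sampleAngle N l))
          - meshInterp N ε lam p (fun φ : ℝ => K (laplacePoint eulerDelta τ lam φ))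
            (sampleAngle N l))
        (∑ j ∈ Finset.range (N + 1), (rootOfUnity N ^ (j * l))⁻¹ • ((lam : ℂ) ^ j • x j))) := by
  have hdata : ∀ l, ∑ j ∈ Finset.range (N + 1),
        ((lam : ℂ) ^ j * (rootOfUnity N ^ (j * l))⁻¹) • x j
      = ∑ j ∈ Finset.range (N + 1), (rootOfUnity N ^ (j * l))⁻¹ • ((lam : ℂ) ^ j • x j) := by
    intro l
    refine Finset.sum_congr rfl fun j _ => ?_
    rw [smul_smul, mul_comm]
  have hgen : ∀ l, cqGenerating τ K N x ((lam : ℂ) * (rootOfUnity N ^ l)⁻¹)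
      = K (laplacePoint eulerDelta τ lam (sampleAngle N l))
        (∑ j ∈ Finset.range (N + 1), (rootOfUnity N ^ (j * l))⁻¹ • ((lam : ℂ) ^ j • x j)) := by
    intro l
    rw [cqGenerating, laplacePoint_sampleAngle]
    congr 1
    refine Finset.sum_congr rfl fun j _ => ?_
    rw [smul_smul, mul_pow, inv_pow, ← pow_mul, mul_comm l j, mul_comm]
  rw [parsimoniousCQ, div_eq_mul_inv, mul_smul, ← smul_sub, ← smul_sub, ← Finset.sum_sub_distrib]
  simp_rw [hdata, hgen, ← smul_sub, sub_apply]

/-- Stability of the scaled trapezoidal rule with respect to perturbations of the operators. -/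
theorem sum_norm_sq_perturbation_le {N : ℕ} (hN : N ≠ 0) {lam : ℝ} (h0 : 0 < lam) (h1 : lam < 1)
    (D : ℕ → X →L[ℂ] Y) {η : ℝ} (hD : ∀ l < N, ‖D l‖ ≤ η) {x : ℕ → X}
    (hx : x 0 = 0) :
    ∑ n ∈ Finset.range (N + 1), ‖((lam : ℂ) ^ n)⁻¹ • ((N : ℂ)⁻¹ • ∑ l ∈ Finset.range N,
        rootOfUnity N ^ (l * n) • D l
          (∑ j ∈ Finset.range (N + 1), (rootOfUnity N ^ (j * l))⁻¹ • ((lam : ℂ) ^ j • x j)))‖ ^ 2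
      ≤ (lam ^ (2 * N))⁻¹ * (2 * (η ^ 2 * ∑ j ∈ Finset.range (N + 1), ‖x j‖ ^ 2)) := by
  set w : ℕ → Y := fun n => (N : ℂ)⁻¹ • ∑ l ∈ Finset.range N, rootOfUnity N ^ (l * n) • D l
          (∑ j ∈ Finset.range (N + 1), (rootOfUnity N ^ (j * l))⁻¹ • ((lam : ℂ) ^ j • x j)) with hw
  -- Dropping the zero datum leaves the indices `1, …, N`, distinct modulo `N`, as Parseval with `N`
  -- nodes requires.
  have hshift : ∀ f : ℕ → X, f 0 = 0 →
      ∑ j ∈ Finset.range (N + 1), f j = ∑ j ∈ Finset.Ico 1 (N + 1), f j := by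
    intro f hf
    rw [Finset.range_eq_Ico, Finset.sum_eq_sum_Ico_succ_bot (by omega), hf, zero_add]
  have hmul : ∑ n ∈ Finset.range N, ‖w n‖ ^ 2
      ≤ η ^ 2 * ∑ j ∈ Finset.range (N + 1), ‖x j‖ ^ 2 := by
    refine (sum_norm_sq_multiplier_le hN (Finset.Ico 1 (N + 1)) ?_
      (fun j => ((lam : ℂ) ^ j) • x j) _ (κ := η) ?_).trans ?_
    · intro i hi j hj hij
      rw [Finset.mem_Ico] at hi hj
      rcases lt_trichotomy i j with h | h | h
      · obtain ⟨d, hd⟩ : N ∣ j - i := (Nat.modEq_iff_dvd' h.le).mp hij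
        have := Nat.le_of_dvd (by omega) (Dvd.intro d hd.symm)
        omega
      · exact h
      · obtain ⟨d, hd⟩ : N ∣ i - j := (Nat.modEq_iff_dvd' h.le).mp hij.symm
        have := Nat.le_of_dvd (by omega) (Dvd.intro d hd.symm)
        omega
    · intro l hl
      rw [← hshift _ (by simp [hx])]
      exact (D l).le_of_opNorm_le (hD l hl) _
    · refine mul_le_mul_of_nonneg_left ?_ (sq_nonneg η)
      refine (Finset.sum_le_sum_of_subset_of_nonneg (t := Finset.range (N + 1)) ?_
        fun _ _ _ => by positivity).trans ?_
      · intro j hj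
        rw [Finset.mem_Ico] at hj
        exact Finset.mem_range.mpr hj.2
      · gcongr with j hj
        rw [norm_smul, norm_pow, Complex.norm_real, Real.norm_of_nonneg h0.le]
        exact mul_le_of_le_one_left (norm_nonneg _) (pow_le_one₀ h0.le h1.le)
  -- By periodicity the entry `n = N` repeats the entry `0`, so the sum over `N + 1` indices at most
  -- doubles.
  have hwN : w N = w 0 := by
    simp only [hw]
    congr 1
    refine Finset.sum_congr rfl fun l _ => ?_
    rw [mul_comm l N, pow_mul, (rootOfUnity_isPrimitiveRoot hN).pow_eq_one, one_pow, mul_zero,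
      pow_zero]
  have hw0 : ‖w 0‖ ^ 2 ≤ ∑ n ∈ Finset.range N, ‖w n‖ ^ 2 :=
    Finset.single_le_sum (f := fun n => ‖w n‖ ^ 2) (fun _ _ => sq_nonneg _)
      (Finset.mem_range.mpr (Nat.pos_of_ne_zero hN))
  have hterm : ∀ n ∈ Finset.range (N + 1), ‖((lam : ℂ) ^ n)⁻¹ • w n‖ ^ 2
      ≤ (lam ^ (2 * N))⁻¹ * ‖w n‖ ^ 2 := by
    intro n hn
    have hnN : n ≤ N := Nat.lt_succ_iff.mp (Finset.mem_range.mp hn)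
    rw [norm_smul, mul_pow, norm_inv, norm_pow, Complex.norm_real, Real.norm_of_nonneg h0.le,
      inv_pow, ← pow_mul]
    gcongr ?_ * _
    exact inv_anti₀ (by positivity) (pow_le_pow_of_le_one h0.le h1.le (by omega))
  calc _ ≤ ∑ n ∈ Finset.range (N + 1), (lam ^ (2 * N))⁻¹ * ‖w n‖ ^ 2 :=
        Finset.sum_le_sum hterm
    _ = (lam ^ (2 * N))⁻¹ * (∑ n ∈ Finset.range N, ‖w n‖ ^ 2 + ‖w 0‖ ^ 2) := by
        rw [← Finset.mul_sum, Finset.sum_range_succ, hwN]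
    _ ≤ _ := by
        gcongr
        linarith

end CQ

/-! ### The discrete norm -/

section DiscreteNorm

variable {E : Type*} [NormedAddCommGroup E]

/-- Writing the norm as a scaled Euclidean norm on `Fin (N + 1)` supplies the triangle inequality.
-/
theorem discreteNorm_eq (N : ℕ) (x : ℕ → E) :
    discreteNorm N x
      = Real.sqrt ((N : ℝ)⁻¹) * ‖(WithLp.toLp 2 fun n : Fin (N + 1) => x n)‖ := by
  rw [discreteNorm, Real.sqrt_mul (by positivity), PiLp.norm_eq_of_L2, ← Fin.sum_univ_eq_sum_range
    (fun n => ‖x n‖ ^ 2)]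

theorem discreteNorm_sub_le (N : ℕ) (x y z : ℕ → E) :
    discreteNorm N (fun n => x n - z n)
      ≤ discreteNorm N (fun n => x n - y n) + discreteNorm N (fun n => y n - z n) := by
  simp only [discreteNorm_eq]
  rw [← mul_add]
  refine mul_le_mul_of_nonneg_left ?_ (Real.sqrt_nonneg _)
  refine le_trans (le_of_eq ?_) (norm_add_le _ _)
  congr 1
  ext n
  simp

theorem discreteNorm_sub_comm (N : ℕ) (x y : ℕ → E) :
    discreteNorm N (fun n => x n - y n) = discreteNorm N (fun n => y n - x n) := by
  simp only [discreteNorm, norm_sub_rev]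

theorem discreteNorm_le_of_sum_le {F : Type*} [NormedAddCommGroup F] {N : ℕ}
    {x : ℕ → E} {y : ℕ → F} {c : ℝ} (hc : 0 ≤ c)
    (h : ∑ n ∈ Finset.range (N + 1), ‖x n‖ ^ 2
      ≤ c ^ 2 * ∑ n ∈ Finset.range (N + 1), ‖y n‖ ^ 2) :
    discreteNorm N x ≤ c * discreteNorm N y := by
  have hcs := Real.sqrt_sq hc
  rw [discreteNorm, discreteNorm, ← hcs, ← Real.sqrt_mul (sq_nonneg c)]
  refine Real.sqrt_le_sqrt ?_
  calc _ ≤ (N : ℝ)⁻¹ * (c ^ 2 * ∑ n ∈ Finset.range (N + 1), ‖y n‖ ^ 2) := by gcongr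
    _ = _ := by ring

end DiscreteNorm

/-! ### The error of parsimonious convolution quadrature -/

/-- With `x = α/N ≤ α`: `1 - e^{-x} ≥ x/(1+x) ≥ x/(1+α)`. On the aliasing circle this keeps `|1 -
z|/τ` above a constant independent of `N`. -/
theorem exp_neg_div_lt_one_sub {α : ℝ} (hα : 0 < α) {N : ℕ} (hN : 1 ≤ N) :
    α / (1 + α) / N ≤ 1 - Real.exp (-(α / N)) := by
  have hNR : (1 : ℝ) ≤ N := by exact_mod_cast hN
  have hx : 0 < α / N := by positivity
  have hxα : α / N ≤ α := div_le_self hα.le hNR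
  have h1 : Real.exp (-(α / N)) ≤ 1 / (1 + α / N) := by
    rw [Real.exp_neg, ← one_div]
    exact one_div_le_one_div_of_le (by positivity) (by linarith [Real.add_one_le_exp (α / N)])
  have h2 : α / (1 + α) / N = (α / N) / (1 + α) := by ring
  have h3 : (α / N) / (1 + α) ≤ (α / N) / (1 + α / N) := by gcongr
  have h4 : 1 - 1 / (1 + α / N) = (α / N) / (1 + α / N) := by
    field_simp
    ring
  linarith

/-- The error of parsimonious CQ with respect to CQ, for operators bounded by `B` at the relevant
points. -/
theorem discreteNorm_cq_sub_parsimoniousCQ_le {X Y : Type*}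
    [NormedAddCommGroup X] [InnerProductSpace ℂ X] [NormedAddCommGroup Y] [InnerProductSpace ℂ Y]
    [CompleteSpace Y] {N : ℕ} (hN : 1 ≤ N) {τ T ε ε₀ α : ℝ} (hτ : 0 < τ) (hτT : τ = T / N)
    (hε : 0 < ε) (hεε₀ : ε ≤ ε₀) (hε₀ : ε₀ < 1) (hα : α = -Real.log ε₀ / 4)
    (hφ : 0 < meshPoint N ε (paramLambda N ε) 0) (hφ' : meshPoint N ε (paramLambda N ε) 0 ≤ 4 / 5)
    {K : ℂ → X →L[ℂ] Y} (hK : DifferentiableOn ℂ K {s : ℂ | 0 < s.re}) {c₁ B : ℝ} (hB0 : 0 ≤ B)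
    (hc1 : c₁ ≤ α / (1 + α) / T)
    (hc2 : c₁ ≤ Real.sin (7 / 8 * meshPoint N ε (paramLambda N ε) 0) / τ)
    (hB : ∀ s : ℂ, 0 < s.re → c₁ ≤ ‖s‖ → ‖s‖ ≤ (1 + Real.exp 2) / τ → ‖K s‖ ≤ B)
    {x : ℕ → X} (hx : x 0 = 0) :
    discreteNorm N (fun n => cq eulerDelta τ K x n
        - parsimoniousCQ eulerDelta N N τ ε (paramLambda N ε) (paramDegree ε) K x n)
      ≤ (Real.sqrt (2 / (ε₀ * (1 - Real.sqrt ε₀))) + 10) * (Real.sqrt ε * B)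
        * discreteNorm N x := by
  have hN0 : N ≠ 0 := by omega
  have hNpos : (0 : ℝ) < N := by exact_mod_cast Nat.pos_of_ne_zero hN0
  have hε1 : ε < 1 := hεε₀.trans_lt hε₀
  have hε₀pos : 0 < ε₀ := hε.trans_le hεε₀
  set lam := paramLambda N ε with hlam
  have h0 : 0 < lam := Real.rpow_pos_of_pos hε _
  have h1 : lam < 1 := Real.rpow_lt_one hε.le hε1 (by positivity)
  have hlamN : lam ^ (2 * N) = ε := by
    rw [hlam, paramLambda, ← Real.rpow_natCast, ← Real.rpow_mul hε.le]
    push_cast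
    rw [one_div_mul_cancel (by positivity), Real.rpow_one]
  have hp : 1 / 2 ^ (paramDegree ε) ≤ ε := by
    have hle : -Real.logb 2 ε ≤ paramDegree ε := Nat.le_ceil _
    rw [← Real.rpow_natCast, one_div, ← Real.rpow_neg (by norm_num),
      ← Real.le_logb_iff_rpow_le (by norm_num) hε]
    linarith
  set S := ∑ n ∈ Finset.range (N + 1), ‖x n‖ ^ 2 with hS
  have hS0 : 0 ≤ S := Finset.sum_nonneg fun _ _ => sq_nonneg _
  set trap : ℕ → Y := fun n => ((lam : ℂ) ^ n)⁻¹ • ((N : ℂ)⁻¹ • ∑ l ∈ Finset.range N,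
        rootOfUnity N ^ (l * n) • cqGenerating τ K N x ((lam : ℂ) * (rootOfUnity N ^ l)⁻¹))
    with htrap
  -- The interpolation error `7 ε B`, times `√2` and `λ^{-N} = ε^{-1/2}`, is at most `10 √ε B`.
  have hint : discreteNorm N (fun n => trap n
      - parsimoniousCQ eulerDelta N N τ ε lam (paramDegree ε) K x n)
      ≤ 10 * (Real.sqrt ε * B) * discreteNorm N x := by
    refine discreteNorm_le_of_sum_le (by positivity) ?_
    simp only [htrap, parsimoniousCQ_sub_eq]
    refine (sum_norm_sq_perturbation_le hN0 h0 h1 _ (η := 7 / 2 ^ (paramDegree ε) * B) ?_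
      hx).trans ?_
    · intro l _
      refine norm_sub_meshInterp_le h0 h1 hφ hφ' hK hτ hB0 ?_ _ (sampleAngle_le N l)
      exact fun s hs hs1 hs2 => hB s hs (hc2.trans hs1) hs2
    · rw [hlamN]
      have h7 : 7 / 2 ^ (paramDegree ε) * B ≤ 7 * ε * B := by
        rw [div_eq_mul_one_div]
        gcongr
      calc ε⁻¹ * (2 * ((7 / 2 ^ (paramDegree ε) * B) ^ 2 * S))
          ≤ ε⁻¹ * (2 * ((7 * ε * B) ^ 2 * S)) := by gcongr
        _ = 98 * (ε * B ^ 2 * S) := by field_simp; ring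
        _ ≤ 100 * (ε * B ^ 2 * S) := by gcongr; norm_num
        _ = (10 * (Real.sqrt ε * B)) ^ 2 * S := by
            rw [mul_pow, mul_pow, Real.sq_sqrt hε.le]; ring
  have halias : discreteNorm N (fun n => trap n - cq eulerDelta τ K x n)
      ≤ Real.sqrt (2 / (ε₀ * (1 - Real.sqrt ε₀))) * (Real.sqrt ε * B) * discreteNorm N x := by
    refine discreteNorm_le_of_sum_le (by positivity) ?_
    set β := Real.sqrt ε₀ with hβ
    have hβ0 : 0 < β := Real.sqrt_pos.mpr hε₀pos
    have hβ1 : β < 1 := by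
      rw [hβ, Real.sqrt_lt' one_pos]
      simpa using hε₀
    have hββ : β ^ 2 = ε₀ := Real.sq_sqrt hε₀pos.le
    have hαpos : 0 < α := by
      rw [hα]
      have := Real.log_neg hε₀pos hε₀
      linarith
    -- The radius satisfies `r^{2N} = √ε₀`, independently of `ε`. Hence `(λ/r)^{2N} = ε/√ε₀ ≤ √ε₀ <
    -- 1`, while `1 - r` is still of order `1/N`, comparable to `τ`.
    set r := Real.exp (-(α / N)) with hr
    have hr0 : 0 < r := Real.exp_pos _
    have hr1 : r < 1 := by
      rw [hr, Real.exp_lt_one_iff, neg_neg_iff_pos]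
      positivity
    have hrN : r ^ (2 * N) = β := by
      rw [hr, ← Real.exp_nat_mul, hβ, Real.sqrt_eq_rpow, Real.rpow_def_of_pos hε₀pos, hα]
      congr 1
      push_cast
      field_simp
      ring
    have hq : (lam / r) ^ (2 * N) = ε / β := by rw [div_pow, hlamN, hrN]
    have hqβ : ε / β ≤ β := by
      rw [div_le_iff₀ hβ0, ← sq, hββ]
      exact hεε₀
    have hcq : ∀ n ∈ Finset.range (N + 1),
        ‖trap n - cq eulerDelta τ K x n‖ ^ 2 = ‖trap n - cqFull τ K N x n‖ ^ 2 := by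
      intro n hn
      rw [cqFull_eq_cq (Nat.lt_succ_iff.mp (Finset.mem_range.mp hn))]
    rw [Finset.sum_congr rfl hcq]
    refine (sum_norm_sq_aliasing_le (x := x) (fun z hz => hasSum_cqFull hK hτ N x hz) (cqFull_zero hx)
      h0 h1 hr0 hr1 hN0 (κ := B) ?_ hq (hqβ.trans_lt hβ1)).trans ?_
    · intro z hz
      rw [cqGenerating]
      refine (K _).le_of_opNorm_le ?_ _
      have hnorm : ‖eulerDelta z / (τ : ℂ)‖ = ‖1 - z‖ / τ := by
        rw [norm_div, Complex.norm_real, Real.norm_of_nonneg hτ.le, eulerDelta]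
      refine hB _ (re_eulerDelta_div_pos hτ (by rw [hz]; exact hr1)) ?_ ?_
      · refine hc1.trans ?_
        have hlow : 1 - r ≤ ‖1 - z‖ := by
          have := norm_sub_norm_le (1 : ℂ) z
          rwa [norm_one, hz] at this
        have h2 := exp_neg_div_lt_one_sub hαpos hN
        rw [hnorm, le_div_iff₀ hτ]
        refine le_trans (le_of_eq ?_) (h2.trans hlow)
        have hT : T ≠ 0 := by
          rintro rfl
          simp [hτT] at hτ
        rw [hτT]
        field_simp
      · rw [hnorm]
        gcongr
        have := norm_sub_le (1 : ℂ) z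
        rw [norm_one, hz] at this
        linarith [Real.add_one_le_exp (2 : ℝ)]
    · rw [hrN, mul_pow, Real.sq_sqrt (div_nonneg (by norm_num)
        (mul_nonneg hε₀pos.le (by linarith))), mul_pow, Real.sq_sqrt hε.le]
      have h1β : 0 < 1 - β := by linarith
      have hd : ε / β / (1 - ε / β) ≤ ε / β / (1 - β) := by gcongr
      calc β⁻¹ * (ε / β / (1 - ε / β)) * (2 * (B ^ 2 * S))
          ≤ β⁻¹ * (ε / β / (1 - β)) * (2 * (B ^ 2 * S)) := by gcongr
        _ = 2 / (ε₀ * (1 - β)) * (ε * B ^ 2) * S := by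
            rw [← hββ]
            field_simp
  calc _ ≤ discreteNorm N (fun n => cq eulerDelta τ K x n - trap n)
        + discreteNorm N (fun n => trap n
          - parsimoniousCQ eulerDelta N N τ ε lam (paramDegree ε) K x n) :=
        discreteNorm_sub_le N _ _ _
    _ ≤ _ := by
        rw [discreteNorm_sub_comm]
        linarith

/-- The power is largest at one end of the interval. For `μ ≥ 0` the right end gives `τ^{-μ} ≤ T
τ^{-(μ+1)}`; for `μ < 0` the left end gives a constant, absorbed because `τ ≤ T` and `μ + 1 ≥ 0`. -/
theorem rpow_le_of_le_div {μ c₁ c₂ T τ x : ℝ} (hμ : -1 ≤ μ) (hc₁ : 0 < c₁) (hτ : 0 < τ)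
    (hτT : τ ≤ T) (hc₂ : 0 < c₂) (h1 : c₁ ≤ x) (h2 : x ≤ c₂ / τ) :
    x ^ μ ≤ (c₁ ^ μ * T ^ (μ + 1) + c₂ ^ μ * T) * τ ^ (-(μ + 1)) := by
  have hT : 0 < T := hτ.trans_le hτT
  have hτp : 0 < τ ^ (-(μ + 1)) := Real.rpow_pos_of_pos hτ _
  have hp1 : 0 < c₁ ^ μ * T ^ (μ + 1) :=
    mul_pos (Real.rpow_pos_of_pos hc₁ _) (Real.rpow_pos_of_pos hT _)
  have hp2 : 0 < c₂ ^ μ * T := mul_pos (Real.rpow_pos_of_pos hc₂ _) hT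
  rw [add_mul]
  rcases le_or_gt 0 μ with h | h
  · have h3 : x ^ μ ≤ (c₂ / τ) ^ μ := Real.rpow_le_rpow (hc₁.le.trans h1) h2 h
    have h4 : (c₂ / τ) ^ μ = c₂ ^ μ * τ * τ ^ (-(μ + 1)) := by
      rw [Real.div_rpow hc₂.le hτ.le, show -(μ + 1) = -μ - 1 by ring, Real.rpow_sub_one hτ.ne',
        Real.rpow_neg hτ.le]
      field_simp
    have h5 : c₂ ^ μ * τ * τ ^ (-(μ + 1)) ≤ c₂ ^ μ * T * τ ^ (-(μ + 1)) := by gcongr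
    have := mul_pos hp1 hτp
    linarith
  · have h3 : x ^ μ ≤ c₁ ^ μ := Real.rpow_le_rpow_of_nonpos hc₁ h1 h.le
    have h4 : T ^ (-(μ + 1)) ≤ τ ^ (-(μ + 1)) :=
      Real.rpow_le_rpow_of_nonpos hτ hτT (by linarith)
    have h5 : c₁ ^ μ = c₁ ^ μ * T ^ (μ + 1) * T ^ (-(μ + 1)) := by
      rw [mul_assoc, ← Real.rpow_add hT, add_neg_cancel, Real.rpow_zero, mul_one]
    have h6 : c₁ ^ μ * T ^ (μ + 1) * T ^ (-(μ + 1))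
        ≤ c₁ ^ μ * T ^ (μ + 1) * τ ^ (-(μ + 1)) := by gcongr
    have := mul_pos hp2 hτp
    linarith

/-- This identity explains the exponent `2(k + μ + 1)` in `ε`: the root and the operator growth
`τ^{-(μ+1)}` combine to `τ^k`. -/
theorem sqrt_paramEps_mul {k μ τ εmach : ℝ} (hτ : 0 < τ) :
    Real.sqrt (paramEps k μ τ εmach) * τ ^ (-(μ + 1))
      = max (τ ^ k) (τ ^ (-(μ + 1)) * Real.sqrt εmach) := by
  have hmono : Monotone Real.sqrt := fun _ _ => Real.sqrt_le_sqrt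
  have h1 : Real.sqrt (τ ^ (2 * (k + μ + 1))) = τ ^ (k + μ + 1) := by
    rw [mul_comm, Real.rpow_mul hτ.le, Real.rpow_ofNat,
      Real.sqrt_sq (Real.rpow_pos_of_pos hτ _).le]
  rw [paramEps, hmono.map_max, h1, max_mul_of_nonneg _ _ (Real.rpow_pos_of_pos hτ _).le,
    ← Real.rpow_add hτ, mul_comm (Real.sqrt εmach)]
  congr 2
  ring

/-! ### The parameters -/

section Parameters

open Filter Topology

theorem paramEps_pos {k μ τ εmach : ℝ} (hτ : 0 < τ) : 0 < paramEps k μ τ εmach :=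
  (Real.rpow_pos_of_pos hτ _).trans_le (le_max_left _ _)

theorem meshPoint_zero_eq (N : ℕ) {ε lam : ℝ} (hε0 : 0 < ε) (hε1 : ε < 1) :
    meshPoint N ε lam 0 = Real.sqrt (5 / 3 * -Real.log ε / N) := by
  rw [meshPoint, abs_of_neg (Real.log_neg hε0 hε1)]
  congr 1
  ring

/-- Since `ε ≥ τ^{2(k+μ+1)}`, the logarithm is `O(log N)` uniformly in `ε_mach`. -/
theorem neg_log_paramEps_le {k μ T εmach : ℝ} (hkμ : 0 < k + μ + 1) (hT : 0 < T) {N : ℕ}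
    (hN : 1 ≤ Real.log N) :
    -Real.log (paramEps k μ (T / N) εmach)
      ≤ 2 * (k + μ + 1) * (1 + |Real.log T|) * Real.log N := by
  have hNpos : (0 : ℝ) < N := by
    rcases Nat.eq_zero_or_pos N with rfl | h
    · norm_num at hN
    · exact_mod_cast h
  have hτ : 0 < T / N := by positivity
  have h1 : Real.log ((T / N) ^ (2 * (k + μ + 1))) ≤ Real.log (paramEps k μ (T / N) εmach) :=
    Real.log_le_log (Real.rpow_pos_of_pos hτ _) (le_max_left _ _)
  rw [Real.log_rpow hτ, Real.log_div hT.ne' hNpos.ne'] at h1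
  have h2 : Real.log N - Real.log T ≤ (1 + |Real.log T|) * Real.log N := by
    have := neg_abs_le (Real.log T)
    have := abs_nonneg (Real.log T)
    nlinarith
  calc _ ≤ 2 * (k + μ + 1) * (Real.log N - Real.log T) := by linarith
    _ ≤ 2 * (k + μ + 1) * ((1 + |Real.log T|) * Real.log N) := by gcongr
    _ = _ := by ring

/-- These conditions determine `N₀`: they yield `ε ≤ ε₀` and, through the last one, `Φ₀ ≤ 4/5`. -/
theorem eventually_parameters {k μ T ε₀ : ℝ} (hkμ : 0 < k + μ + 1) (hε₀ : 0 < ε₀) :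
    ∀ᶠ N : ℕ in atTop, 1 ≤ N ∧ 1 ≤ Real.log N ∧ (T / N) ^ (2 * (k + μ + 1)) ≤ ε₀ ∧
      5 / 3 * (2 * (k + μ + 1) * (1 + |Real.log T|) * Real.log N) / N ≤ (4 / 5) ^ 2 := by
  have hN := tendsto_natCast_atTop_atTop (R := ℝ)
  have h1 : ∀ᶠ N : ℕ in atTop, 1 ≤ Real.log N :=
    (Real.tendsto_log_atTop.comp hN).eventually_ge_atTop 1
  have h2 : Tendsto (fun N : ℕ => (T / N) ^ (2 * (k + μ + 1))) atTop (𝓝 0) := by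
    have := (hN.const_div_atTop T).rpow_const (p := 2 * (k + μ + 1)) (Or.inr (by positivity))
    rwa [Real.zero_rpow (by positivity)] at this
  have h3 : Tendsto (fun N : ℕ => 5 / 3 * (2 * (k + μ + 1) * (1 + |Real.log T|) * Real.log N) / N)
      atTop (𝓝 0) := by
    have hlog : Tendsto (fun x : ℝ => Real.log x / x) atTop (𝓝 0) := by
      have := Real.isLittleO_log_id_atTop.tendsto_div_nhds_zero
      simpa using this
    have := (hlog.comp hN).const_mul (5 / 3 * (2 * (k + μ + 1) * (1 + |Real.log T|)))
    rw [mul_zero] at this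
    refine this.congr fun N => ?_
    simp only [Function.comp_apply]
    ring
  filter_upwards [eventually_ge_atTop 1, h1, h2.eventually (ge_mem_nhds hε₀),
    h3.eventually (ge_mem_nhds (by norm_num : (0 : ℝ) < (4 / 5) ^ 2))] with N ha hb hc hd
  exact ⟨ha, hb, hc, hd⟩

theorem one_le_paramDegree {ε : ℝ} (hε0 : 0 < ε) (hε1 : ε < 1) : 1 ≤ paramDegree ε := by
  rw [paramDegree, Nat.one_le_ceil_iff, neg_pos]
  exact Real.logb_neg (by norm_num) hε0 hε1

theorem paramDegree_le {ε : ℝ} (hε0 : 0 < ε) (hε1 : ε < 1) :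
    (paramDegree ε : ℝ) ≤ 2 * -Real.log ε + 1 := by
  have hpos : 0 ≤ -Real.logb 2 ε := (neg_pos.mpr (Real.logb_neg (by norm_num) hε0 hε1)).le
  have h1 : (paramDegree ε : ℝ) < -Real.logb 2 ε + 1 := Nat.ceil_lt_add_one hpos
  have h2 : -Real.logb 2 ε ≤ 2 * -Real.log ε := by
    have hl : 0 < -Real.log ε := neg_pos.mpr (Real.log_neg hε0 hε1)
    have hlog2 : 1 / 2 ≤ Real.log 2 := by linarith [Real.log_two_gt_d9]
    rw [Real.logb, ← neg_div, div_le_iff₀ (by linarith)]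
    nlinarith
  linarith

end Parameters

/-! ### The main theorem -/

theorem eq_zero_of_causal {X : Type*} [NormedAddCommGroup X] {g : ℝ → X} (hg : Continuous g)
    (hcausal : ∀ t : ℝ, t < 0 → g t = 0) : g 0 = 0 := by
  have hcl : IsClosed {t | g t = 0} := isClosed_eq hg continuous_const
  have hsub : closure (Iio (0 : ℝ)) ⊆ {t | g t = 0} :=
    hcl.closure_subset_iff.mpr fun t ht => hcausal t ht
  rw [closure_Iio] at hsub
  exact hsub (mem_Iic.mpr le_rfl)

theorem ParsimoniousCQ.IsTransferFamily.nonneg {X Y : Type*} [NormedAddCommGroup X]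
    [NormedSpace ℂ X] [NormedAddCommGroup Y] [NormedSpace ℂ Y] {K : ℂ → X →L[ℂ] Y} {μ M₀ : ℝ}
    (hK : IsTransferFamily K μ M₀) : 0 ≤ M₀ := by
  have := (norm_nonneg _).trans (hK.bound 1 (by simp))
  simpa using this

/-- Jordan's inequality `sin y ≥ 2y/π`, with `2/π ≥ 4/7`. -/
theorem half_le_sin {x : ℝ} (h0 : 0 ≤ x) (h1 : x ≤ 4 / 5) : x / 2 ≤ Real.sin (7 / 8 * x) := by
  have hpi : 4 / 7 ≤ 2 / Real.pi := by
    rw [le_div_iff₀ Real.pi_pos]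
    linarith [Real.pi_lt_d2]
  calc x / 2 = 4 / 7 * (7 / 8 * x) := by ring
    _ ≤ 2 / Real.pi * (7 / 8 * x) := mul_le_mul_of_nonneg_right hpi (by positivity)
    _ ≤ Real.sin (7 / 8 * x) := Real.mul_le_sin (by positivity) (by linarith [Real.pi_gt_three])

theorem mainTheorem3 (μ k T ε₀ : ℝ) (hμ : -1 ≤ μ) (hk : 0 < k) (hT : 0 < T)
    (hε₀ : 0 < ε₀) (hε₀' : ε₀ < 1) :
    ∃ (C : ℝ) (N₀ : ℕ), 0 < C ∧ 1 ≤ N₀ ∧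
      ∀ (N : ℕ), N₀ ≤ N → ∀ (εmach : ℝ), 0 ≤ εmach → εmach ≤ ε₀ →
      ∀ (τ ε lam : ℝ) (p M : ℕ), τ = T / N → ε = paramEps k μ τ εmach → p = paramDegree ε →
        lam = paramLambda N ε → M = meshIndex N ε lam →
        -- the parameters and the mesh are admissible
        (0 < lam ∧ lam < 1) ∧
        (0 < meshPoint N ε lam 0 ∧ StrictMonoOn (meshPoint N ε lam) (Set.Iic M) ∧
          meshPoint N ε lam M = Real.pi) ∧
        -- size of the mesh
        ((mesh N ε lam).ncard = 2 * M + 2 ∧ ((mesh N ε lam).ncard : ℝ) ≤ C * Real.sqrt N) ∧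
        -- number of Laplace domain evaluations
        (((evaluationPoints eulerDelta N N τ ε lam p).length : ℝ)
            ≤ C * (Real.sqrt N * Real.sqrt (Real.log N) + (M : ℝ) * p) ∧
          ((evaluationPoints eulerDelta N N τ ε lam p).length : ℝ)
            ≤ C * (Real.sqrt N * Real.log N) ∧
          ∀ s ∈ evaluationPoints eulerDelta N N τ ε lam p, 0 < s.re) ∧
        ∀ (X : Type u) (Y : Type v) [NormedAddCommGroup X] [InnerProductSpace ℂ X]
          [CompleteSpace X] [NormedAddCommGroup Y] [InnerProductSpace ℂ Y] [CompleteSpace Y],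
          -- the method only uses the values of the transfer operator at these points
          (∀ (K K' : ℂ → X →L[ℂ] Y),
            (∀ s ∈ evaluationPoints eulerDelta N N τ ε lam p, K s = K' s) →
            ∀ (g : ℕ → X) (n : ℕ), parsimoniousCQ eulerDelta N N τ ε lam p K g n
              = parsimoniousCQ eulerDelta N N τ ε lam p K' g n) ∧
          -- preservation of the convergence rate
          ∀ (K : ℂ → X →L[ℂ] Y) (M₀ : ℝ), IsTransferFamily K μ M₀ →
            ∀ (g : ℝ → X) (u : ℝ → Y), IsTemporalConvolution K g u →
            ∀ Ccq : ℝ,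
              discreteNorm N (fun n => u (n * τ) - cq eulerDelta τ K (fun j => g (j * τ)) n)
                ≤ Ccq * τ ^ k * discreteNorm N (fun n => g (n * τ)) →
              (εmach ≤ τ ^ (2 * (k + μ + 1)) →
                discreteNorm N (fun n => u (n * τ)
                    - parsimoniousCQ eulerDelta N N τ ε lam p K (fun j => g (j * τ)) n)
                  ≤ (Ccq + C * M₀) * τ ^ k * discreteNorm N (fun n => g (n * τ))) ∧
              discreteNorm N (fun n => u (n * τ)
                  - parsimoniousCQ eulerDelta N N τ ε lam p K (fun j => g (j * τ)) n)
                ≤ (Ccq * τ ^ k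
                    + C * M₀ * max (τ ^ k) (τ ^ (-(μ + 1)) * Real.sqrt εmach))
                  * discreteNorm N (fun n => g (n * τ)) := by
  obtain ⟨α, hα⟩ : ∃ x, x = -Real.log ε₀ / 4 := ⟨_, rfl⟩
  have hlogε₀ := Real.log_neg hε₀ hε₀'
  have hα0 : 0 < α := by linarith
  have hkμ : 0 < k + μ + 1 := by linarith
  obtain ⟨E, hE⟩ : ∃ x, x = 2 * (k + μ + 1) * (1 + |Real.log T|) := ⟨_, rfl⟩
  have hE0 : 0 < E := by rw [hE]; positivity
  -- From `-log ε ≥ -log ε₀ = 4α` one gets `Φ₀ ≥ c₄/√N`; similarly `-log ε ≤ E log N` gives `Φ₀ ≤ D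
  -- √(log N / N)`.
  obtain ⟨c₄, hc₄⟩ : ∃ x, x = Real.sqrt (5 / 3 * (4 * α)) := ⟨_, rfl⟩
  have hc₄0 : 0 < c₄ := hc₄ ▸ Real.sqrt_pos.mpr (by positivity)
  obtain ⟨D, hD⟩ : ∃ x, x = Real.sqrt (5 / 3 * E) := ⟨_, rfl⟩
  obtain ⟨m₁, hm₁⟩ : ∃ x, x = 2 / c₄ + 1 := ⟨_, rfl⟩
  have hm₁0 : 0 < m₁ := by rw [hm₁]; positivity
  -- A lower bound for `|s|`, uniform in `N`: the first entry serves the aliasing circle, the second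
  -- the ellipses.
  obtain ⟨c₁, hc₁⟩ : ∃ x, x = min (α / (1 + α) / T) (c₄ / (2 * T)) := ⟨_, rfl⟩
  have hc₁0 : 0 < c₁ := hc₁ ▸ lt_min (by positivity) (by positivity)
  have hc₂0 : 0 < 1 + Real.exp 2 := by positivity
  obtain ⟨C₃, hC₃⟩ : ∃ x, x = c₁ ^ μ * T ^ (μ + 1) + (1 + Real.exp 2) ^ μ * T := ⟨_, rfl⟩
  have hC₃0 : 0 < C₃ := hC₃ ▸ add_pos
    (mul_pos (Real.rpow_pos_of_pos hc₁0 _) (Real.rpow_pos_of_pos hT _))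
    (mul_pos (Real.rpow_pos_of_pos hc₂0 _) hT)
  obtain ⟨C₅, hC₅⟩ : ∃ x, x = Real.sqrt (2 / (ε₀ * (1 - Real.sqrt ε₀))) + 10 := ⟨_, rfl⟩
  have hC₅0 : 0 < C₅ := by rw [hC₅]; positivity
  have hD0 : 0 ≤ D := hD ▸ Real.sqrt_nonneg _
  obtain ⟨C, hC⟩ : ∃ x, x = (2 * m₁ + 2) + (D + 2) + 4 + 4 * m₁ * (2 * E + 1) + C₅ * C₃ := ⟨_, rfl⟩
  have hC0 : 0 < C := by rw [hC]; positivity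
  have ht1 : 0 < 4 * m₁ * (2 * E + 1) := by positivity
  have ht2 : 0 < C₅ * C₃ := by positivity
  obtain ⟨N₁, hN₁⟩ := Filter.eventually_atTop.mp
    (eventually_parameters (T := T) hkμ hε₀)
  refine ⟨C, max 1 N₁, hC0, le_max_left _ _, ?_⟩
  intro N hN εmach hεm0 hεm1 τ ε lam p M hτ hε hp hlam hM
  obtain ⟨hN1, hlogN, hετ, hφN⟩ := hN₁ N ((le_max_right _ _).trans hN)
  subst hτ
  have hNR : (1 : ℝ) ≤ N := by exact_mod_cast hN1
  have hNpos : (0 : ℝ) < N := by linarith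
  have hτ0 : 0 < T / N := by positivity
  have hτT : T / N ≤ T := div_le_self hT.le hNR
  have hε0 : 0 < ε := hε ▸ paramEps_pos hτ0
  have hεε₀ : ε ≤ ε₀ := by rw [hε]; exact max_le hετ hεm1
  have hε1 : ε < 1 := hεε₀.trans_lt hε₀'
  have hlogε1 : -Real.log ε ≤ E * Real.log N := by
    rw [hε, hE]; exact neg_log_paramEps_le hkμ hT hlogN
  have hlogε2 : 4 * α ≤ -Real.log ε := by
    have := Real.log_le_log hε0 hεε₀
    linarith
  have h0 : 0 < lam := hlam ▸ Real.rpow_pos_of_pos hε0 _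
  have h1 : lam < 1 := hlam ▸ Real.rpow_lt_one hε0.le hε1 (by positivity)
  set φ := meshPoint N ε lam 0 with hφ
  have hφeq : φ = Real.sqrt (5 / 3 * -Real.log ε / N) := meshPoint_zero_eq N hε0 hε1
  have hsN : 0 < Real.sqrt N := Real.sqrt_pos.mpr hNpos
  have hsN1 : 1 ≤ Real.sqrt N := Real.one_le_sqrt.mpr hNR
  have hsq : Real.sqrt N * Real.sqrt N = N := Real.mul_self_sqrt hNpos.le
  have hφeq' : φ = Real.sqrt (5 / 3 * -Real.log ε) / Real.sqrt N := by
    rw [hφeq, Real.sqrt_div (by linarith)]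
  have hφlow : c₄ / Real.sqrt N ≤ φ := by
    rw [hφeq']
    gcongr
    rw [hc₄]
    exact Real.sqrt_le_sqrt (by linarith)
  have hφ0 : 0 < φ := (div_pos hc₄0 hsN).trans_le hφlow
  have hφ45 : φ ≤ 4 / 5 := by
    rw [hφeq]
    refine Real.sqrt_le_iff.mpr ⟨by norm_num, le_trans ?_ hφN⟩
    rw [← hE]
    gcongr
  have hφ1 : φ < 1 := by linarith
  have hNφ : N * φ ≤ D * (Real.sqrt N * Real.sqrt (Real.log N)) := by
    have h2 : Real.sqrt (5 / 3 * -Real.log ε) ≤ D * Real.sqrt (Real.log N) := by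
      rw [hD, ← Real.sqrt_mul (by positivity)]
      exact Real.sqrt_le_sqrt (by linarith)
    rw [hφeq', mul_div_assoc', div_le_iff₀ hsN]
    calc _ ≤ N * (D * Real.sqrt (Real.log N)) := by gcongr
      _ = D * (Real.sqrt N * Real.sqrt (Real.log N)) * Real.sqrt N := by
        nth_rewrite 1 [← hsq]; ring
  have hMle : (M : ℝ) ≤ m₁ * Real.sqrt N := by
    obtain ⟨m, hm, -, -, -, -, hm2⟩ := exists_meshIndex_eq h0 h1 hφ0 hφ1
    rw [hM, hm]
    push_cast
    have h3 : 2 / φ ≤ 2 / c₄ * Real.sqrt N := by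
      rw [div_le_iff₀ hφ0]
      rw [div_le_iff₀ hsN] at hφlow
      rw [div_mul_eq_mul_div, div_mul_eq_mul_div, le_div_iff₀ hc₄0]
      linarith
    rw [hm₁, add_mul, one_mul]
    linarith
  have hp1 : (1 : ℝ) ≤ p := by rw [hp]; exact_mod_cast one_le_paramDegree hε0 hε1
  have hple : (p : ℝ) ≤ (2 * E + 1) * Real.log N := by
    have := paramDegree_le hε0 hε1
    rw [← hp] at this
    linarith
  have hsl1 : 1 ≤ Real.sqrt (Real.log N) := Real.one_le_sqrt.mpr hlogN
  have hsl2 : Real.sqrt (Real.log N) ≤ Real.log N :=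
    Real.sqrt_le_iff.mpr ⟨by positivity, le_self_pow₀ hlogN two_ne_zero⟩
  have hMp : 0 ≤ (M : ℝ) * p := by positivity
  have hss : 1 ≤ Real.sqrt N * Real.sqrt (Real.log N) := one_le_mul_of_one_le_of_one_le hsN1 hsl1
  have hss2 : Real.sqrt N * Real.sqrt (Real.log N) ≤ Real.sqrt N * Real.log N := by gcongr
  have hlen : ((evaluationPoints eulerDelta N N (T / N) ε lam p).length : ℝ)
      ≤ (D + 2) * (Real.sqrt N * Real.sqrt (Real.log N)) + 4 * (M * p) := by
    refine (length_evaluationPoints_le h0 h1 hφ0 hφ1 hN1 _ _ _).trans ?_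
    rw [← hM, ← hφ]
    -- Since `p ≥ 1`, the `2M(p + 1)` Chebyshev points number at most `4Mp`.
    have : (M : ℝ) ≤ M * p := le_mul_of_one_le_right (Nat.cast_nonneg M) hp1
    linarith
  refine ⟨⟨h0, h1⟩, ⟨hφ0, ?_, ?_⟩, ⟨?_, ?_⟩,
    ⟨?_, ?_, fun s hs => re_pos_of_mem_evaluationPoints h0 h1 hτ0 hs⟩, ?_⟩
  · exact strictMonoOn_Iic_of_lt_succ fun j hj => by
      rw [Order.succ_eq_add_one]
      exact meshPoint_lt_succ h0 h1 hφ0 hφ1 (hM ▸ hj)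
  · rw [hM]
    exact meshPoint_meshIndex h0 h1 hφ0 hφ1
  · rw [hM]
    exact ncard_mesh h0 h1 hφ0 hφ1
  · rw [ncard_mesh h0 h1 hφ0 hφ1, ← hM]
    push_cast
    have : (2 * m₁ + 2) * Real.sqrt N ≤ C * Real.sqrt N := by
      gcongr
      linarith
    linarith
  · refine hlen.trans ?_
    rw [mul_add]
    gcongr <;> linarith
  · refine hlen.trans ?_
    have hMp2 : (M : ℝ) * p ≤ m₁ * (2 * E + 1) * (Real.sqrt N * Real.log N) := by
      calc (M : ℝ) * p ≤ (m₁ * Real.sqrt N) * ((2 * E + 1) * Real.log N) := by gcongr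
        _ = _ := by ring
    calc _ ≤ (D + 2) * (Real.sqrt N * Real.log N)
          + 4 * (m₁ * (2 * E + 1) * (Real.sqrt N * Real.log N)) := by gcongr
      _ = (D + 2 + 4 * m₁ * (2 * E + 1)) * (Real.sqrt N * Real.log N) := by ring
      _ ≤ C * (Real.sqrt N * Real.log N) := by
          gcongr
          linarith
  intro X Y _ _ _ _ _ _
  refine ⟨fun K K' hKK' g n => parsimoniousCQ_congr h0 h1 hφ0 hφ1 hKK' g n, ?_⟩
  intro K M₀ hK g u hu Ccq hcq
  have hM₀ : 0 ≤ M₀ := hK.nonneg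
  set G := discreteNorm N (fun n => g (n * (T / N))) with hG
  have hG0 : 0 ≤ G := Real.sqrt_nonneg _
  have hτp : 0 < (T / N) ^ (-(μ + 1)) := Real.rpow_pos_of_pos hτ0 _
  have hB : ∀ s : ℂ, 0 < s.re → c₁ ≤ ‖s‖ → ‖s‖ ≤ (1 + Real.exp 2) / (T / N) →
      ‖K s‖ ≤ M₀ * (C₃ * (T / N) ^ (-(μ + 1))) := by
    intro s hs hs1 hs2
    refine (hK.bound s hs).trans ?_
    gcongr
    rw [hC₃]
    exact rpow_le_of_le_div hμ hc₁0 hτ0 hτT hc₂0 hs1 hs2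
  have hsin : c₁ ≤ Real.sin (7 / 8 * φ) / (T / N) := by
    have hsin := half_le_sin hφ0.le hφ45
    refine (hc₁.trans_le (min_le_right _ _)).trans ?_
    rw [le_div_iff₀ hτ0]
    refine le_trans ?_ hsin
    have h2 : c₄ / (2 * T) * (T / N) = c₄ / N / 2 := by field_simp
    have h3 : c₄ / N ≤ c₄ / Real.sqrt N := by
      gcongr
      exact Real.sqrt_le_iff.mpr ⟨hNpos.le, le_self_pow₀ hNR two_ne_zero⟩
    rw [h2]
    linarith
  have herr : discreteNorm N (fun n => cq eulerDelta (T / N) K (fun j => g (j * (T / N))) n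
      - parsimoniousCQ eulerDelta N N (T / N) ε lam p K (fun j => g (j * (T / N))) n)
      ≤ C * M₀ * max ((T / N) ^ k) ((T / N) ^ (-(μ + 1)) * Real.sqrt εmach) * G := by
    have hx0 : (fun j : ℕ => g (j * (T / N))) 0 = 0 := by
      simpa using eq_zero_of_causal hu.continuous_data hu.causal_data
    have h2 := discreteNorm_cq_sub_parsimoniousCQ_le hN1 hτ0 rfl hε0 hεε₀ hε₀' hα
      (by rwa [← hlam]) (by rwa [← hlam]) hK.analytic (c₁ := c₁) (by positivity)
      (hc₁.trans_le (min_le_left _ _)) (by rwa [← hlam]) hB (x := fun j => g (j * (T / N))) hx0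
    rw [← hlam, ← hp, ← hC₅] at h2
    rw [← sqrt_paramEps_mul hτ0, ← hε]
    have hle : C₅ * C₃ ≤ C := by linarith
    calc _ ≤ C₅ * (Real.sqrt ε * (M₀ * (C₃ * (T / N) ^ (-(μ + 1))))) * G := h2
      _ = (C₅ * C₃) * (M₀ * (Real.sqrt ε * (T / N) ^ (-(μ + 1))) * G) := by ring
      _ ≤ C * (M₀ * (Real.sqrt ε * (T / N) ^ (-(μ + 1))) * G) := by gcongr
      _ = _ := by ring
  have hmain : discreteNorm N (fun n => u (n * (T / N))
      - parsimoniousCQ eulerDelta N N (T / N) ε lam p K (fun j => g (j * (T / N))) n)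
      ≤ (Ccq * (T / N) ^ k
        + C * M₀ * max ((T / N) ^ k) ((T / N) ^ (-(μ + 1)) * Real.sqrt εmach)) * G := by
    refine (discreteNorm_sub_le N _
      (fun n => cq eulerDelta (T / N) K (fun j => g (j * (T / N))) n) _).trans ?_
    rw [add_mul]
    exact add_le_add hcq herr
  refine ⟨fun hsmall => ?_, hmain⟩
  -- For such `ε_mach` the parameter `ε` is the same as for `ε_mach = 0`, and the identity for `√ε
  -- τ^{-(μ+1)}` evaluates the maximum.
  have hmax : max ((T / N) ^ k) ((T / N) ^ (-(μ + 1)) * Real.sqrt εmach) = (T / N) ^ k := by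
    have he : paramEps k μ (T / N) εmach = paramEps k μ (T / N) 0 := by
      rw [paramEps, paramEps, max_eq_left hsmall,
        max_eq_left (Real.rpow_pos_of_pos hτ0 _).le]
    rw [← sqrt_paramEps_mul hτ0, he, sqrt_paramEps_mul hτ0, Real.sqrt_zero, mul_zero,
      max_eq_left (Real.rpow_pos_of_pos hτ0 _).le]
  rw [hmax] at hmain
  refine hmain.trans (le_of_eq ?_)
  ring
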